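/- **Model.** A downlink network in $\mathbb R^2$ has a finite set $\mathcal S$ of seller operators and a finite set $\mathcal B$ of buyer operators. Seller $s$ owns a finite set $\mathcal L_s$ of sub-bands, disjoint from those of the other sellers; sub-band $l_s\in\mathcal L_s$ is used by a set $Q_{l_s}$ of operators with $s\in Q_{l_s}$ and $Q_{l_s}\setminus\{s\}\subseteq\mathcal B$. Fix a path loss exponent $\alpha>2$, a noise power $\sigma^2\ge 0$, a transmit power $P^{\rm S}>0$ of the base stations (BSs) of sellers, intensities $\lambda_k,\mu_k>0$ for every operator $k$, and thresholds $\zeta_s>0$ for every seller $s$. The BSs of operator $k$ form a homogeneous Poisson process $\Phi_k$ of intensity $\lambda_k$, and the users of $s$ one, $\Psi_s$, of intensity $\mu_s$. All channel gains are exponential with mean $1$. On $l_s$ the maximum allowable power of a buyer BS at a point $x$ is $$P^{\rm B}_{l_s}=\zeta_s/H^{\rm B}_{l_s},\qquad H^{\rm B}_{l_s}=\max_{y_i\in\Psi_s}h_i\|x-y_i\|^{-\alpha},$$ with independent gains $h_i$, independent of $\Psi_s$ (its law does not depend on $x$). The buyer BSs carry transmit powers on $l_s$ with this law. The processes $\Phi_k$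 ($k\in Q_{l_s}$), the gains from their BSs to the typical user, and the transmit powers of the individual buyer BSs are all independent. The typical user of seller $s$ is at the origin and is served by the BS of $s$ with the largest average received power, at distance $x_0$, with gain $h_0$. Its SINR on $l_s$ is $$\gamma_{s,l_s}^{\rm S}=\frac{P^{\rm S}h_0x_0^{-\alpha}}{I+\sigma^2},\qquad I=\sum_{f}P^{\rm S}h_fx_f^{-\alpha}+\sum_{b\in Q_{l_s}\setminus\{s\}}\ \sum_{g\in\Phi_b}P_g h_g x_g^{-\alpha},$$ where $f$ runs over the BSs of $s$ other than the serving one, $x_f,x_g$ are distances to the origin, $h_f,h_g$ are gains, and $P_g$ is the transmit power of the buyer BS $g$. **Theorem 2.** Let $\beta>0$. Then $\mathbb E[(P^{\rm B}_{l_s})^{2/\alpha}]<\infty$, $I<\infty$ almost surely, and the coverage probability of the typical user of $s$ on $l_s$, that is, the expectation over the transmit powers of the buyer BSs of the conditional probability of $\gamma^{\rm S}_{s,l_s}>\beta$ given these powers, is $$\mathcal C_{s,l_s}^{\rm S}=\int_0^\infty \pi\lambda_s (P^{\rm S})^{2/\alpha}\,e^{-\beta\sigma^2z^{\alpha/2}}\,e^{-\pi\lambda_s(P^{\rm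 S})^{2/\alpha}z}\,\mathcal L\big(\beta z^{\alpha/2}\big)\,dz ,$$ a convergent integral, where, with $\lambda_{s,l_s}=\sum_{b\in Q_{l_s}\setminus\{s\}}\lambda_b$, $\rho(\alpha,\beta)=\int_{\beta^{-2/\alpha}}^\infty\frac{d\nu}{1+\nu^{\alpha/2}}$ and $\rho(\alpha,\infty)=\int_0^\infty\frac{d\nu}{1+\nu^{\alpha/2}}$, $$\mathcal L(\kappa)=\exp\!\big(-\pi\lambda_s(P^{\rm S})^{2/\alpha}\kappa^{2/\alpha}\rho(\alpha,\beta)\big)\,\exp\!\big(-\pi\lambda_{s,l_s}\,\mathbb E[(P^{\rm B}_{l_s})^{2/\alpha}]\,\kappa^{2/\alpha}\rho(\alpha,\infty)\big).$$ Moreover $\mathcal L(\beta z^{\alpha/2})$ is the Laplace transform of the interference at $\beta z^{\alpha/2}$ given the serving distance, where $z=x_0^2/(P^{\rm S})^{2/\alpha}$: almost surely, $\mathbb E\big[e^{-\kappa I}\,\big|\,x_0\big]=\mathcal L(\kappa)$ with $\kappa=\beta z^{\alpha/2}=\beta x_0^\alpha/P^{\rm S}$. -/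

import Mathlib

open MeasureTheory ProbabilityTheory Set
open scoped ENNReal NNReal

namespace SpectrumSharing

noncomputable section

/-- The plane in which base stations (BSs) and user equipments (UEs) live, with the Euclidean
norm and Lebesgue measure. -/
abbrev Plane : Type := EuclideanSpace ℝ (Fin 2)

/-- The number of points of the enumerated point configuration `X 0 ω, X 1 ω, …` that lie
in `A`. -/
def count {Ω : Type*} (X : ℕ → Ω → Plane) (A : Set Plane) (ω : Ω) : ℕ∞ :=
  {n : ℕ | X n ω ∈ A}.encard

/-- `X 0, X 1, …` is a (measurable) enumeration of the points of a homogeneous Poisson point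
process of intensity `lam` on the plane: the number of points in a Borel set `A` of finite area is
Poisson with mean `lam * area A`, and the numbers of points in disjoint sets are independent.
(For `lam > 0` such a process has infinitely many points, so that it is enumerated by `ℕ`.) -/
structure IsPoissonProcess {Ω : Type*} [MeasurableSpace Ω] (P : Measure Ω)
    (X : ℕ → Ω → Plane) (lam : ℝ) : Prop where
  measurable : ∀ n, Measurable (X n)
  count_law : ∀ A : Set Plane, MeasurableSet A → volume A < ∞ → ∀ j : ℕ,
    P {ω | count X A ω = j} = poissonMeasure (lam * (volume A).toReal).toNNReal {j}
  count_indep : ∀ (m : ℕ) (A : Fin m → Set Plane), (∀ i, MeasurableSet (A i)) →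
    (∀ i, volume (A i) < ∞) → Pairwise (fun i j => Disjoint (A i) (A j)) →
    iIndepFun (fun i => count X (A i)) P

/-- The deterministic data of the network: seller and buyer operators (MNOs), licensed sub-bands
of the sellers, sharing groups, intensities, thresholds, and the physical constants. -/
structure Network (MNO Band : Type*) [DecidableEq MNO] where
  /-- seller MNOs -/
  sellers : Finset MNO
  /-- buyer MNOs -/
  buyers : Finset MNO
  /-- licensed sub-bands of a seller -/
  bands : MNO → Finset Band
  /-- the MNOs sharing a given sub-band, its owner included -/
  group : Band → Finset MNO
  /-- intensity of the BSs of an MNO -/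
  bsIntensity : MNO → ℝ
  /-- intensity of the UEs of an MNO -/
  ueIntensity : MNO → ℝ
  /-- maximum interference threshold of a seller -/
  threshold : MNO → ℝ
  /-- the fixed transmit power of the BSs of sellers -/
  sellerPower : ℝ
  /-- path loss exponent -/
  α : ℝ
  /-- the noise power is `σ ^ 2` -/
  σ : ℝ
  bands_disjoint : ∀ s ∈ sellers, ∀ t ∈ sellers, s ≠ t → Disjoint (bands s) (bands t)
  seller_mem_group : ∀ s ∈ sellers, ∀ l ∈ bands s, s ∈ group l
  group_subset : ∀ s ∈ sellers, ∀ l ∈ bands s, (group l).erase s ⊆ buyers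
  bsIntensity_pos : ∀ k ∈ sellers ∪ buyers, 0 < bsIntensity k
  ueIntensity_pos : ∀ k ∈ sellers ∪ buyers, 0 < ueIntensity k
  threshold_pos : ∀ s ∈ sellers, 0 < threshold s
  sellerPower_pos : 0 < sellerPower
  two_lt_α : 2 < α

/-- The random objects of the network. The typical seller UE is at the origin. -/
structure Randomness (MNO Band Ω : Type*) where
  /-- `bs k n` is the location of BS number `n` of MNO `k` -/
  bs : MNO → ℕ → Ω → Plane
  /-- `ue k i` is the location of UE number `i` of MNO `k` -/
  ue : MNO → ℕ → Ω → Plane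
  /-- `gain l k n`: channel gain on `l` between BS `n` of MNO `k` and the typical UE of the seller
  that owns `l` -/
  gain : Band → MNO → ℕ → Ω → ℝ
  /-- `ueGain l i`: channel gain on `l` between UE `i` of the seller that owns `l` and a given
  buyer BS -/
  ueGain : Band → ℕ → Ω → ℝ
  /-- `power l k n`: transmit power on `l` of BS `n` of the buyer MNO `k` -/
  power : Band → MNO → ℕ → Ω → ℝ

variable {MNO Band Ω : Type*} [DecidableEq MNO]

/-- The largest interference channel gain, on sub-band `l` of seller `s`, from a buyer BS located
at `x` to the UEs of `s`. -/
def maxGain (N : Network MNO Band) (F : Randomness MNO Band Ω) (s : MNO) (l : Band) (x : Plane)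
    (ω : Ω) : ℝ :=
  ⨆ i : ℕ, F.ueGain l i ω * ‖x - F.ue s i ω‖ ^ (-N.α)

/-- The maximum allowable transmit power, on sub-band `l` of seller `s`, of a buyer BS located
at `x`. -/
def buyerPower (N : Network MNO Band) (F : Randomness MNO Band Ω) (s : MNO) (l : Band) (x : Plane)
    (ω : Ω) : ℝ :=
  N.threshold s / maxGain N F s l x ω

/-- Labels of the independent sources of randomness that enter the SINR of the typical UE of
seller `s` on `l`: the BS process of each MNO of the sharing group, the channel gain of each of
their BSs, and the transmit power of each buyer BS. -/
inductive Source (N : Network MNO Band) (s : MNO) (l : Band) : Type _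
  | bs (k : {k // k ∈ N.group l})
  | gain (k : {k // k ∈ N.group l}) (n : ℕ)
  | power (k : {k // k ∈ (N.group l).erase s}) (n : ℕ)

/-- The σ-algebra generated by a source of randomness. -/
@[reducible] def Source.sigma {N : Network MNO Band} {s : MNO} {l : Band} (F : Randomness MNO Band Ω) :
    Source N s l → MeasurableSpace Ω
  | .bs k => MeasurableSpace.comap (fun ω n => F.bs k n ω) inferInstance
  | .gain k n => MeasurableSpace.comap (F.gain l k n) inferInstance
  | .power k n => MeasurableSpace.comap (F.power l k n) inferInstance

/-- Labels of the sources of randomness in the power of a buyer BS at a given location: the UE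
process of the seller and the channel gains to its UEs. -/
inductive UESource : Type
  | ue
  | gain (i : ℕ)

/-- The σ-algebra generated by such a source of randomness. -/
@[reducible] def UESource.sigma (F : Randomness MNO Band Ω) (s : MNO) (l : Band) : UESource → MeasurableSpace Ω
  | .ue => MeasurableSpace.comap (fun ω i => F.ue s i ω) inferInstance
  | .gain i => MeasurableSpace.comap (F.ueGain l i) inferInstance

/-- The probabilistic model on sub-band `l` of seller `s`. All BS processes, and the UE process of
`s`, are homogeneous Poisson processes, and all channel gains are exponential with unit mean. The
transmit powers of the buyer BSs are independent marks of these BSs, independent of the locations and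
of the gains, each with the law of the maximum allowable power of a buyer
BS (whose law is computed at a location `x`). -/
structure IsModel [MeasurableSpace Ω] (P : Measure Ω) (N : Network MNO Band)
    (F : Randomness MNO Band Ω) (s : MNO) (l : Band) (x : Plane) : Prop where
  bs_poisson : ∀ k ∈ N.group l, IsPoissonProcess P (F.bs k) (N.bsIntensity k)
  ue_poisson : IsPoissonProcess P (F.ue s) (N.ueIntensity s)
  gain_measurable : ∀ k ∈ N.group l, ∀ n, Measurable (F.gain l k n)
  gain_law : ∀ k ∈ N.group l, ∀ n, P.map (F.gain l k n) = expMeasure 1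
  ueGain_measurable : ∀ i, Measurable (F.ueGain l i)
  ueGain_law : ∀ i, P.map (F.ueGain l i) = expMeasure 1
  ue_indep : iIndep (UESource.sigma F s l) P
  power_measurable : ∀ k ∈ (N.group l).erase s, ∀ n, Measurable (F.power l k n)
  power_law : ∀ k ∈ (N.group l).erase s, ∀ n,
    IdentDistrib (F.power l k n) (buyerPower N F s l x) P P
  indep : iIndep (Source.sigma (N := N) (s := s) (l := l) F) P

/-- The average power (fading has unit mean) received at the origin from BS `n` of seller `s`. -/
def meanRxPower (N : Network MNO Band) (F : Randomness MNO Band Ω) (s : MNO) (n : ℕ) (ω : Ω) : ℝ :=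
  N.sellerPower * ‖F.bs s n ω‖ ^ (-N.α)

/-- The BS of seller `s` with which the typical UE at the origin is associated: the one with
maximum average received power (almost surely there is exactly one). -/
def servingBS (N : Network MNO Band) (F : Randomness MNO Band Ω) (s : MNO) (ω : Ω) : ℕ :=
  sInf {n | ∀ m, meanRxPower N F s m ω ≤ meanRxPower N F s n ω}

/-- The distance of the typical UE to its serving BS. -/
def servingDist (N : Network MNO Band) (F : Randomness MNO Band Ω) (s : MNO) (ω : Ω) : ℝ :=
  ‖F.bs s (servingBS N F s ω) ω‖

/-- The interference at the typical UE of seller `s` on `l`: from all other BSs of `s`, and from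
all BSs of the buyers that share `l`. -/
def interference (N : Network MNO Band) (F : Randomness MNO Band Ω) (s : MNO) (l : Band)
    (ω : Ω) : ℝ≥0∞ :=
  (∑' n : {n : ℕ // n ≠ servingBS N F s ω},
      ENNReal.ofReal (N.sellerPower * F.gain l s n ω * ‖F.bs s n ω‖ ^ (-N.α))) +
    ∑ b ∈ (N.group l).erase s, ∑' n : ℕ,
      ENNReal.ofReal (F.power l b n ω * F.gain l b n ω * ‖F.bs b n ω‖ ^ (-N.α))

/-- The downlink SINR at the typical UE of seller `s` on `l`. -/
def sinr (N : Network MNO Band) (F : Randomness MNO Band Ω) (s : MNO) (l : Band) (ω : Ω) : ℝ≥0∞ :=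
  ENNReal.ofReal (N.sellerPower * F.gain l s (servingBS N F s ω) ω *
      servingDist N F s ω ^ (-N.α)) /
    (interference N F s l ω + ENNReal.ofReal (N.σ ^ 2))

/-- The σ-algebra generated by the transmit powers on `l` of all the buyer BSs. -/
@[reducible] def powerSigma (N : Network MNO Band) (F : Randomness MNO Band Ω) (s : MNO) (l : Band) :
    MeasurableSpace Ω :=
  MeasurableSpace.comap
    (fun ω (k : {k // k ∈ (N.group l).erase s}) (n : ℕ) => F.power l k n ω) inferInstance

/-- SINR coverage probability of the typical UE of seller `s` on `l`: the expectation, over the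
transmit powers of the buyer BSs, of the probability given these powers that the SINR is
above `β`. -/
def coverage [MeasurableSpace Ω] (P : Measure Ω) (N : Network MNO Band) (F : Randomness MNO Band Ω)
    (s : MNO) (l : Band) (β : ℝ) : ℝ :=
  ∫ ω, (P⟦{ω' | ENNReal.ofReal β < sinr N F s l ω'} | powerSigma N F s l⟧) ω ∂P

/-- `ρ(α, β)` -/
def rho (α β : ℝ) : ℝ := ∫ ν in Ioi (β ^ (-2 / α)), 1 / (1 + ν ^ (α / 2))

/-- `ρ(α, ∞)` -/
def rhoInfty (α : ℝ) : ℝ := ∫ ν in Ioi (0 : ℝ), 1 / (1 + ν ^ (α / 2))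

/-- The total intensity of the BSs of the buyers sharing `l`. -/
def buyerIntensity (N : Network MNO Band) (s : MNO) (l : Band) : ℝ :=
  ∑ b ∈ (N.group l).erase s, N.bsIntensity b

/-- The moment of order `2 / α` of the transmit power of a buyer BS. -/
def powerMoment [MeasurableSpace Ω] (P : Measure Ω) (N : Network MNO Band)
    (F : Randomness MNO Band Ω) (s : MNO) (l : Band) (x : Plane) : ℝ :=
  ∫ ω, buyerPower N F s l x ω ^ (2 / N.α) ∂P

/-- The closed form of the Laplace transform of the interference, at `κ`: the factor of the BSs of
the seller times the factor of the BSs of the buyers. -/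
def laplaceFormula [MeasurableSpace Ω] (P : Measure Ω) (N : Network MNO Band)
    (F : Randomness MNO Band Ω) (s : MNO) (l : Band) (x : Plane) (β κ : ℝ) : ℝ :=
  Real.exp (-(Real.pi * N.bsIntensity s * N.sellerPower ^ (2 / N.α) * κ ^ (2 / N.α) *
      rho N.α β)) *
    Real.exp (-(Real.pi * buyerIntensity N s l * powerMoment P N F s l x * κ ^ (2 / N.α) *
      rhoInfty N.α))

/-- The integrand of the coverage probability. -/
def coverageIntegrand [MeasurableSpace Ω] (P : Measure Ω) (N : Network MNO Band)
    (F : Randomness MNO Band Ω) (s : MNO) (l : Band) (x : Plane) (β z : ℝ) : ℝ :=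
  Real.pi * N.bsIntensity s * N.sellerPower ^ (2 / N.α) *
    Real.exp (-(β * N.σ ^ 2 * z ^ (N.α / 2))) *
    Real.exp (-(Real.pi * N.bsIntensity s * N.sellerPower ^ (2 / N.α) * z)) *
    laplaceFormula P N F s l x β (β * z ^ (N.α / 2))

end

end SpectrumSharing

open Filter Topology

/-! Everything rests on the Laplace functional of a Poisson process, `E exp (-∑ u(Xₙ)) = exp (-λ ∫
(1 - exp (-u)))`, stated for weights in `[0, ∞]` with `exp (-∞) = 0`. For simple functions it is the
Poisson generating function together with independence over disjoint sets; monotone limits give the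
rest (`IsPoissonProcess.lintegral_expNeg_tsum`). Independent marks can be averaged out one at a
time, which yields `IsPoissonProcess.lintegral_expNeg_tsum_marked`. Allowing the weight `∞` puts
void events inside the same formula: an infinite weight on a set produces the indicator that no
point lies there.

Three uses follow. An infinite weight on users that would raise the largest gain above a level
bounds the tail of the power of a buyer, so its moment of order `2 / α` is finite. Exponential gains
and the substitution `v = ‖y‖ ^ 2` turn the exponents into multiples of `∫ dv / (1 + v ^ (α / 2))`.
Independence of the operators multiplies their factors (`lintegral_void_mul_expNeg`), and letting
the argument tend to `0` shows that the interference is almost surely finite.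

Conditioning on the serving distance `D` is done without Palm calculus. Let `t` be fixed and count
only seller stations at distance at least `t`, at the argument `κ = β t ^ α / Pˢ`. On the void event
`r ≤ D`, with `r ≤ t`, the transform is `P (r ≤ D)` times a factor that does not depend on `r`.
Subtracting the case `r = t` gives the same identity on the cell `r ≤ D < t`
(`IsModel.lintegral_cell_farFactor`). Summing over a grid and refining it, almost surely only the
serving station is eventually left out of the far sum, so the identity passes to the limit against
bounded continuous functions of `D`, which determine the conditional transform.

For coverage, the SINR exceeds `β` exactly when the gain of the serving station exceeds `κ (I +
σ²)`. The serving index depends on positions only, so this gain can be integrated out and leaves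
`exp (-κ (I + σ²))` (`IsModel.measure_lt_servingGain`). The conditional transform replaces `exp (-κ
I)` by the closed form, and void probabilities show that `D ^ 2`, rescaled, is exponential, which
gives the integral in `z`. -/

namespace SpectrumSharing

noncomputable section

/-! ### The exponential on the extended half-line. -/

section

/-- The function `a ↦ exp (-a)` on `[0, ∞]`, with `exp (-∞) = 0`. -/
def expNeg (a : ℝ≥0∞) : ℝ≥0∞ := EReal.exp (-(a : EReal))

@[simp] lemma expNeg_zero : expNeg 0 = 1 := by simp [expNeg]

@[simp] lemma expNeg_top : expNeg ∞ = 0 := by simp [expNeg]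

lemma expNeg_add (a b : ℝ≥0∞) : expNeg (a + b) = expNeg a * expNeg b := by
  rw [expNeg, expNeg, expNeg, ← EReal.exp_add, EReal.coe_ennreal_add, EReal.neg_add, sub_eq_add_neg]
  · left; simp
  · right; simp

lemma expNeg_ofReal {x : ℝ} (hx : 0 ≤ x) :
    expNeg (ENNReal.ofReal x) = ENNReal.ofReal (Real.exp (-x)) := by
  rw [expNeg, EReal.coe_ennreal_ofReal, max_eq_left hx, ← EReal.coe_neg, EReal.exp_coe]

lemma expNeg_eq_ofReal_exp {a : ℝ≥0∞} (ha : a ≠ ∞) :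
    expNeg a = ENNReal.ofReal (Real.exp (-a.toReal)) := by
  rw [← expNeg_ofReal ENNReal.toReal_nonneg, ENNReal.ofReal_toReal ha]

lemma continuous_expNeg : Continuous expNeg :=
  ENNReal.continuous_exp.comp (continuous_neg.comp continuous_coe_ennreal_ereal)

@[fun_prop] lemma measurable_expNeg : Measurable expNeg := continuous_expNeg.measurable

lemma expNeg_strictAnti : StrictAnti expNeg := fun _ _ h =>
  EReal.exp_strictMono (EReal.neg_lt_neg_iff.2 (EReal.coe_ennreal_lt_coe_ennreal_iff.2 h))

lemma expNeg_antitone : Antitone expNeg := expNeg_strictAnti.antitone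

lemma expNeg_le_one (a : ℝ≥0∞) : expNeg a ≤ 1 := by
  simpa using expNeg_antitone (zero_le (a := a))

lemma expNeg_ne_top (a : ℝ≥0∞) : expNeg a ≠ ∞ := ne_top_of_le_ne_top (by simp) (expNeg_le_one a)

lemma expNeg_eq_zero {a : ℝ≥0∞} : expNeg a = 0 ↔ a = ∞ := by
  rw [← expNeg_top]; exact expNeg_strictAnti.injective.eq_iff

lemma expNeg_sum {ι : Type*} (s : Finset ι) (f : ι → ℝ≥0∞) :
    expNeg (∑ i ∈ s, f i) = ∏ i ∈ s, expNeg (f i) := by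
  classical
  induction s using Finset.induction_on with
  | empty => simp
  | insert a s ha ih => rw [Finset.sum_insert ha, Finset.prod_insert ha, expNeg_add, ih]

/-- The inverse of `expNeg` on `[0, 1]`. -/
def negLog (w : ℝ≥0∞) : ℝ≥0∞ := (-(ENNReal.log w)).toENNReal

lemma measurable_negLog : Measurable negLog :=
  (measurable_ereal_toENNReal).comp (continuous_neg.measurable.comp ENNReal.measurable_log)

lemma expNeg_negLog {w : ℝ≥0∞} (hw : w ≤ 1) : expNeg (negLog w) = w := by
  have h : ENNReal.log w ≤ 0 := by simpa using hw
  rw [expNeg, negLog, EReal.coe_toENNReal, neg_neg, ENNReal.exp_log]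
  rwa [EReal.neg_nonneg]

/-- Convergence of `∫ exp (-f n)`, by dominated convergence. -/
lemma tendsto_lintegral_expNeg {Ω : Type*} [MeasurableSpace Ω] {P : Measure Ω} [IsFiniteMeasure P]
    {f : ℕ → Ω → ℝ≥0∞} {g : Ω → ℝ≥0∞} (hf : ∀ n, Measurable (f n))
    (h : ∀ᵐ ω ∂P, Tendsto (fun n => f n ω) atTop (𝓝 (g ω))) :
    Tendsto (fun n => ∫⁻ ω, expNeg (f n ω) ∂P) atTop (𝓝 (∫⁻ ω, expNeg (g ω) ∂P)) := by
  refine tendsto_lintegral_of_dominated_convergence (fun _ => 1)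
    (fun n => measurable_expNeg.comp (hf n)) (fun n => ae_of_all _ fun ω => expNeg_le_one _)
    (by simp) ?_
  filter_upwards [h] with ω hω
  exact (continuous_expNeg.tendsto _).comp hω

end

/-! ### The Laplace functional of a Poisson process. -/

section

lemma coe_count {Ω : Type*} {X : ℕ → Ω → Plane} (A : Set Plane) (ω : Ω) :
    (count X A ω : ℝ≥0∞) = ∑' n, A.indicator (fun _ => 1) (X n ω) := by
  rw [count, ← ENNReal.tsum_set_one, tsum_subtype {n | X n ω ∈ A} (fun _ => (1 : ℝ≥0∞))]
  rfl

variable {Ω : Type*} [MeasurableSpace Ω] {P : Measure Ω} {X : ℕ → Ω → Plane} {lam : ℝ}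

lemma measurable_coe_count (hX : ∀ n, Measurable (X n)) {A : Set Plane} (hA : MeasurableSet A) :
    Measurable (fun ω => (count X A ω : ℝ≥0∞)) := by
  simp_rw [coe_count]
  exact Measurable.tsum fun n => (measurable_const.indicator hA).comp (hX n)

lemma measurable_count (hX : ∀ n, Measurable (X n)) {A : Set Plane} (hA : MeasurableSet A) :
    Measurable (count X A) := by
  refine measurable_to_countable' fun j => ?_
  have : count X A ⁻¹' {j} = (fun ω => (count X A ω : ℝ≥0∞)) ⁻¹' {(j : ℝ≥0∞)} := by
    ext ω; simp
  rw [this]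
  exact measurable_coe_count hX hA (measurableSet_singleton _)

/-- The model prescribes only the masses at finite values, so an atom at `⊤` has to be excluded. The
Poisson law is the restriction of the law of the count to the finite values, hence is bounded by it;
two ordered probability measures are equal. -/
lemma IsPoissonProcess.map_count [IsProbabilityMeasure P] (hX : IsPoissonProcess P X lam)
    {A : Set Plane} (hA : MeasurableSet A) (hA' : volume A < ∞) :
    P.map (count X A) =
      (poissonMeasure (lam * (volume A).toReal).toNNReal).map (Nat.cast : ℕ → ℕ∞) := by
  have hm := measurable_count hX.measurable hA
  have hP : IsProbabilityMeasure (P.map (count X A)) := Measure.isProbabilityMeasure_map hm.aemeasurable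
  have hcast : MeasurableEmbedding (Nat.cast : ℕ → ℕ∞) :=
    ⟨Nat.cast_injective, measurable_of_countable _, fun _ _ => MeasurableSet.of_discrete⟩
  have hQ : IsProbabilityMeasure
      ((poissonMeasure (lam * (volume A).toReal).toNNReal).map (Nat.cast : ℕ → ℕ∞)) :=
    Measure.isProbabilityMeasure_map hcast.measurable.aemeasurable
  have h1 : poissonMeasure (lam * (volume A).toReal).toNNReal =
      (P.map (count X A)).comap (Nat.cast : ℕ → ℕ∞) := by
    refine Measure.ext_of_singleton fun j => ?_
    rw [hcast.comap_apply, image_singleton, Measure.map_apply hm (measurableSet_singleton _),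
      ← hX.count_law A hA hA' j]
    rfl
  symm
  refine Measure.eq_of_le_of_isProbabilityMeasure ?_
  rw [h1, hcast.map_comap]
  exact Measure.restrict_le_self

/-- The generating function of a Poisson variable: the exponential series at `m * exp (-c)`. -/
lemma IsPoissonProcess.lintegral_expNeg_count [IsProbabilityMeasure P]
    (hX : IsPoissonProcess P X lam) (hlam : 0 ≤ lam) {A : Set Plane} (hA : MeasurableSet A)
    (hA' : volume A < ∞) {c : ℝ≥0∞} (hc : c ≠ ∞) :
    ∫⁻ ω, expNeg (c * count X A ω) ∂P =
      expNeg (ENNReal.ofReal lam * ((1 - expNeg c) * volume A)) := by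
  have hm := measurable_count hX.measurable hA
  have hcast : Measurable (Nat.cast : ℕ → ℕ∞) := measurable_of_countable _
  lift c to ℝ≥0 using hc
  have e1 : ∫⁻ ω, expNeg (c * count X A ω) ∂P =
      ∫⁻ j : ℕ∞, expNeg (c * (j : ℝ≥0∞)) ∂(P.map (count X A)) :=
    (lintegral_map (f := fun j : ℕ∞ => expNeg (c * (j : ℝ≥0∞))) (measurable_of_countable _) hm).symm
  rw [e1, hX.map_count hA hA', lintegral_map (measurable_of_countable _) hcast,
    lintegral_countable']
  set m := lam * (volume A).toReal with hmdef
  have hm0 : 0 ≤ m := by positivity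
  have e2 : ∀ j : ℕ, expNeg (c * ((j : ℕ∞) : ℝ≥0∞)) * poissonMeasure m.toNNReal {j} =
      ENNReal.ofReal (Real.exp (-m) * ((m * Real.exp (-c)) ^ j / j.factorial)) := by
    intro j
    have : (c * ((j : ℕ∞) : ℝ≥0∞)) = ENNReal.ofReal (c * j) := by
      rw [ENNReal.ofReal_mul c.coe_nonneg]; simp
    rw [this, expNeg_ofReal (by positivity), poissonMeasure_singleton, ← ENNReal.ofReal_mul (by positivity),
      Real.coe_toNNReal _ hm0, mul_pow m, ← Real.exp_nat_mul]
    congr 1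
    rw [show -((c : ℝ) * j) = j * (-c) by ring]
    ring
  rw [tsum_congr e2]
  have hs := (Real.summable_pow_div_factorial (m * Real.exp (-c))).mul_left (Real.exp (-m))
  rw [← ENNReal.ofReal_tsum_of_nonneg (fun j => by positivity) hs, tsum_mul_left,
    ← congrFun (NormedSpace.exp_eq_tsum_div (𝔸 := ℝ)), ← Real.exp_eq_exp_ℝ, ← Real.exp_add]
  have e3 : (1 - expNeg c) * volume A = ENNReal.ofReal ((1 - Real.exp (-c)) * (volume A).toReal) := by
    rw [ENNReal.ofReal_mul (by simp), ENNReal.ofReal_toReal hA'.ne,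
      ENNReal.ofReal_sub _ (Real.exp_pos _).le, ENNReal.ofReal_one, ← ENNReal.ofReal_coe_nnreal, expNeg_ofReal c.coe_nonneg]
  have h0 : 0 ≤ 1 - Real.exp (-(c : ℝ)) := by simp
  rw [e3, ← ENNReal.ofReal_mul hlam, expNeg_ofReal (by positivity)]
  congr 2
  rw [hmdef]; ring

lemma IsPoissonProcess.lintegral_expNeg_sum_count [IsProbabilityMeasure P]
    (hX : IsPoissonProcess P X lam) (hlam : 0 ≤ lam) {m : ℕ} {A : Fin m → Set Plane}
    (hA : ∀ i, MeasurableSet (A i)) (hA' : ∀ i, volume (A i) < ∞)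
    (hd : Pairwise (fun i j => Disjoint (A i) (A j))) {c : Fin m → ℝ≥0∞} (hc : ∀ i, c i ≠ ∞) :
    ∫⁻ ω, expNeg (∑ i, c i * count X (A i) ω) ∂P =
      expNeg (ENNReal.ofReal lam * ∑ i, (1 - expNeg (c i)) * volume (A i)) := by
  simp_rw [expNeg_sum, Finset.mul_sum, expNeg_sum]
  have hi := (hX.count_indep m A hA hA' hd).comp
    (fun i (j : ℕ∞) => expNeg (c i * (j : ℝ≥0∞))) (fun i => measurable_of_countable _)
  have := lintegral_prod_eq_prod_lintegral_of_indepFun Finset.univ _ hi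
    (fun i => (measurable_of_countable _).comp (measurable_count hX.measurable (hA i)))
  simp only [Function.comp_def] at this
  rw [this]
  exact Finset.prod_congr rfl fun i _ => hX.lintegral_expNeg_count hlam (hA i) (hA' i) (hc i)

/-- The sum over the points regroups into counts in the level sets at nonzero values, which are
disjoint and of finite area. -/
lemma IsPoissonProcess.lintegral_expNeg_simpleFunc [IsProbabilityMeasure P]
    (hX : IsPoissonProcess P X lam) (hlam : 0 ≤ lam) (f : SimpleFunc Plane ℝ≥0∞)
    (hf : ∀ y, f y ≠ ∞) (hf' : volume {y | f y ≠ 0} < ∞) :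
    ∫⁻ ω, expNeg (∑' n, f (X n ω)) ∂P =
      expNeg (ENNReal.ofReal lam * ∫⁻ y, (1 - expNeg (f y))) := by
  classical
  set S := f.range.erase 0 with hS
  let e := S.equivFin.symm
  let A : Fin S.card → Set Plane := fun i => f ⁻¹' {(e i : ℝ≥0∞)}
  have hne : ∀ i, (e i : ℝ≥0∞) ≠ 0 := fun i => (Finset.mem_erase.1 (e i).2).1
  have hfin : ∀ i, (e i : ℝ≥0∞) ≠ ∞ := fun i => by
    obtain ⟨y, hy⟩ := SimpleFunc.mem_range.1 (Finset.mem_erase.1 (e i).2).2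
    rw [← hy]; exact hf y
  have key := hX.lintegral_expNeg_sum_count hlam (A := A) (c := fun i => (e i : ℝ≥0∞))
    (fun i => f.measurableSet_fiber _)
    (fun i => (measure_mono fun y (hy : f y = e i) => by
      simpa [hy] using hne i).trans_lt hf')
    (fun i j hij => by
      refine Set.disjoint_left.2 fun y (h1 : f y = e i) (h2 : f y = e j) => hij ?_
      exact e.injective (Subtype.ext (h1.symm.trans h2))) hfin
  have hsum : ∀ g : ℝ≥0∞ → ℝ≥0∞, ∑ i, g (e i : ℝ≥0∞) = ∑ c ∈ S, g c := fun g => by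
    rw [Equiv.sum_comp e (fun c : S => g c), Finset.sum_coe_sort S g]
  have h1 : ∀ ω, ∑ i, (e i : ℝ≥0∞) * count X (A i) ω = ∑' n, f (X n ω) := by
    intro ω
    simp_rw [coe_count, ← ENNReal.tsum_mul_left]
    rw [← Summable.tsum_finsetSum (fun _ _ => ENNReal.summable)]
    refine tsum_congr fun n => ?_
    rw [show (∑ i, (e i : ℝ≥0∞) * (A i).indicator (fun _ => 1) (X n ω)) =
      ∑ c ∈ S, c * (f ⁻¹' {c}).indicator (fun _ => 1) (X n ω) from
        hsum fun c => c * (f ⁻¹' {c}).indicator (fun _ => 1) (X n ω)]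
    by_cases h0 : f (X n ω) = 0
    · rw [h0]
      refine Finset.sum_eq_zero fun c hc => ?_
      rw [indicator_of_notMem, mul_zero]
      simpa [h0] using (Finset.mem_erase.1 hc).1.symm
    · rw [Finset.sum_eq_single (f (X n ω))]
      · simp
      · intro c _ hc
        rw [indicator_of_notMem, mul_zero]
        simpa using hc.symm
      · intro h
        exact absurd (Finset.mem_erase.2 ⟨h0, SimpleFunc.mem_range_self _ _⟩) h
  have h2 : ∑ i, (1 - expNeg (e i)) * volume (A i) = ∫⁻ y, (1 - expNeg (f y)) := by
    rw [show (∑ i, (1 - expNeg (e i)) * volume (A i)) = ∑ c ∈ S, (1 - expNeg c) * volume (f ⁻¹' {c})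
      from hsum fun c => (1 - expNeg c) * volume (f ⁻¹' {c})]
    have : ∫⁻ y, (1 - expNeg (f y)) = (f.map fun c => 1 - expNeg c).lintegral volume := by
      rw [← SimpleFunc.lintegral_eq_lintegral]; rfl
    rw [this, SimpleFunc.map_lintegral]
    refine Finset.sum_subset (Finset.erase_subset _ _) fun c hc hc' => ?_
    have : c = 0 := by
      by_contra h; exact hc' (Finset.mem_erase.2 ⟨h, hc⟩)
    simp [this]
  rw [← h2, ← key]
  simp_rw [h1]

/-- The Laplace functional of a Poisson process. -/
theorem IsPoissonProcess.lintegral_expNeg_tsum [IsProbabilityMeasure P]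
    (hX : IsPoissonProcess P X lam) (hlam : 0 ≤ lam) {u : Plane → ℝ≥0∞} (hu : Measurable u) :
    ∫⁻ ω, expNeg (∑' n, u (X n ω)) ∂P =
      expNeg (ENNReal.ofReal lam * ∫⁻ y, (1 - expNeg (u y))) := by
  -- Cutting off to growing balls gives the approximants supports of finite area, as the simple case
  -- requires, and keeps them increasing.
  let f : ℕ → SimpleFunc Plane ℝ≥0∞ := fun k =>
    (SimpleFunc.eapprox u k).restrict (Metric.ball 0 (k : ℝ))
  have hfa : ∀ k y, f k y = (Metric.ball 0 (k : ℝ)).indicator (SimpleFunc.eapprox u k) y :=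
    fun k y => SimpleFunc.restrict_apply _ Metric.isOpen_ball.measurableSet _
  have hmono : ∀ y, Monotone (fun k => f k y) := by
    intro y i j hij
    simp only [hfa]
    refine (indicator_le_indicator (SimpleFunc.monotone_eapprox u hij y)).trans ?_
    exact indicator_le_indicator_of_subset (Metric.ball_subset_ball (by exact_mod_cast hij))
      (fun _ => zero_le) y
  have hlim : ∀ y, Tendsto (fun k => f k y) atTop (𝓝 (u y)) := by
    intro y
    have h := tendsto_atTop_iSup (fun i j hij => SimpleFunc.monotone_eapprox u hij y :
      Monotone fun k => SimpleFunc.eapprox u k y)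
    rw [SimpleFunc.iSup_eapprox_apply hu] at h
    refine h.congr' ?_
    obtain ⟨K, hK⟩ := exists_nat_gt ‖y‖
    filter_upwards [eventually_ge_atTop K] with k hk
    rw [hfa, indicator_of_mem]
    rw [mem_ball_zero_iff]
    exact hK.trans_le (by exact_mod_cast hk)
  have key : ∀ k, ∫⁻ ω, expNeg (∑' n, f k (X n ω)) ∂P =
      expNeg (ENNReal.ofReal lam * ∫⁻ y, (1 - expNeg (f k y))) := fun k => by
    refine hX.lintegral_expNeg_simpleFunc hlam (f k) (fun y => ?_) ?_
    · rw [hfa]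
      refine ne_top_of_le_ne_top (SimpleFunc.eapprox_lt_top u k y).ne (indicator_le_self _ _ _)
    · refine (measure_mono fun y hy => ?_).trans_lt (measure_ball_lt_top (x := (0 : Plane)) (r := (k : ℝ)))
      by_contra h
      exact hy (by rw [hfa, indicator_of_notMem h])
  have hL : Tendsto (fun k => ∫⁻ ω, expNeg (∑' n, f k (X n ω)) ∂P) atTop
      (𝓝 (∫⁻ ω, expNeg (∑' n, u (X n ω)) ∂P)) := by
    refine tendsto_lintegral_expNeg (fun k => Measurable.tsum fun n =>
      (f k).measurable.comp (hX.measurable n)) (ae_of_all _ fun ω => ?_)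
    -- The sum is an integral against the counting measure, so monotone convergence applies to it.
    simp_rw [← lintegral_count]
    exact lintegral_tendsto_of_tendsto_of_monotone
      (fun k => (measurable_of_countable _).aemeasurable) (ae_of_all _ fun n => hmono _)
      (ae_of_all _ fun n => hlim _)
  have hR : Tendsto (fun k => ∫⁻ y, (1 - expNeg (f k y))) atTop (𝓝 (∫⁻ y, (1 - expNeg (u y)))) := by
    refine lintegral_tendsto_of_tendsto_of_monotone (fun k => ?_) (ae_of_all _ fun y => ?_)
      (ae_of_all _ fun y => ?_)
    · exact (measurable_const.sub (measurable_expNeg.comp (f k).measurable)).aemeasurable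
    · exact fun i j hij => tsub_le_tsub_left (expNeg_antitone (hmono y hij)) 1
    · exact ENNReal.Tendsto.sub tendsto_const_nhds ((continuous_expNeg.tendsto _).comp (hlim y))
        (Or.inl (by simp))
  simp_rw [key] at hL
  refine tendsto_nhds_unique hL ((continuous_expNeg.tendsto _).comp ?_)
  exact ENNReal.Tendsto.const_mul hR (Or.inr (by simp))

end

/-! ### Independent marks. -/

section

/-- Integrating out a variable that is independent of the rest. -/
lemma lintegral_comp_prodMk_of_indepFun {Ω S E : Type*} [MeasurableSpace Ω] {P : Measure Ω}
    [IsProbabilityMeasure P] [MeasurableSpace S] [MeasurableSpace E] {A : Ω → S} {M : Ω → E}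
    (hA : Measurable A) (hM : Measurable M) (h : IndepFun A M P) {H : S × E → ℝ≥0∞}
    (hH : Measurable H) :
    ∫⁻ ω, H (A ω, M ω) ∂P = ∫⁻ ω, ∫⁻ m, H (A ω, m) ∂(P.map M) ∂P := by
  have : IsProbabilityMeasure (P.map M) := Measure.isProbabilityMeasure_map hM.aemeasurable
  rw [← lintegral_map hH (hA.prodMk hM),
    (indepFun_iff_map_prod_eq_prod_map_map hA.aemeasurable hM.aemeasurable).1 h,
    lintegral_prod _ hH.aemeasurable, lintegral_map hH.lintegral_prod_right' hA]

/-- The formula for independent pairs is applied to the identity map from `Ω` to `Ω` with the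
σ-algebra `𝓐`: this single random variable carries all the information in `𝓐`. -/
lemma lintegral_comp_of_indep {Ω E : Type*} {𝓐 mΩ : MeasurableSpace Ω} {P : Measure Ω}
    [IsProbabilityMeasure P] [mE : MeasurableSpace E] {M : Ω → E} (h𝓐 : 𝓐 ≤ mΩ)
    (hM : Measurable M) (h : Indep (mE.comap M) 𝓐 P) {H : Ω × E → ℝ≥0∞}
    (hH : Measurable[𝓐.prod mE] H) :
    ∫⁻ ω, H (ω, M ω) ∂P = ∫⁻ ω, ∫⁻ m, H (ω, m) ∂(P.map M) ∂P := by
  have hI : @IndepFun Ω Ω E mΩ 𝓐 mE id M P := by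
    refine (@IndepFun_iff_Indep Ω Ω E mΩ 𝓐 mE id M P).2 ?_
    rw [MeasurableSpace.comap_id]
    exact h.symm
  exact @lintegral_comp_prodMk_of_indepFun Ω Ω E mΩ P _ 𝓐 mE id M
    (measurable_id'' h𝓐) hM hI H hH

variable {Ω E : Type*} [MeasurableSpace Ω] {P : Measure Ω} {X : ℕ → Ω → Plane} {lam : ℝ}

/-- The σ-algebra generated by the points of an enumerated configuration. -/
@[reducible] def pointSigma (X : ℕ → Ω → Plane) : MeasurableSpace Ω :=
  MeasurableSpace.comap (fun ω k => X k ω) inferInstance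

/-- The σ-algebra generated by the points and the first `n` marks. -/
@[reducible] def markedSigma [mE : MeasurableSpace E] (X : ℕ → Ω → Plane) (M : ℕ → Ω → E) (n : ℕ) :
    MeasurableSpace Ω :=
  pointSigma X ⊔ ⨆ j ∈ {j | j < n}, mE.comap (M j)

lemma pointSigma_le (hX : ∀ n, Measurable (X n)) : pointSigma X ≤ ‹MeasurableSpace Ω› :=
  (measurable_pi_lambda _ hX).comap_le

lemma measurable_pointSigma {Ω : Type*} (X : ℕ → Ω → Plane) (n : ℕ) :
    Measurable[pointSigma X] (X n) :=
  (measurable_pi_apply n).comp (comap_measurable (fun ω k => X k ω))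

lemma markedSigma_le [MeasurableSpace E] (hX : ∀ n, Measurable (X n)) {M : ℕ → Ω → E}
    (hM : ∀ n, Measurable (M n)) (n : ℕ) : markedSigma X M n ≤ ‹MeasurableSpace Ω› :=
  sup_le (pointSigma_le hX) (iSup₂_le fun j _ => (hM j).comap_le)

lemma pointSigma_le_markedSigma {Ω : Type*} [MeasurableSpace E] (X : ℕ → Ω → Plane)
    (M : ℕ → Ω → E) (n : ℕ) : pointSigma X ≤ markedSigma X M n := le_sup_left

lemma measurable_markedSigma {Ω : Type*} [mE : MeasurableSpace E] (X : ℕ → Ω → Plane)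
    (M : ℕ → Ω → E) {j n : ℕ} (hj : j < n) : Measurable[markedSigma X M n] (M j) :=
  (comap_measurable (M j)).mono
    ((le_iSup₂ (f := fun j (_ : j ∈ {j | j < n}) => mE.comap (M j)) j hj).trans le_sup_right) le_rfl

/-- Independent marks can be replaced by their conditional means in products. -/
lemma lintegral_mul_prod_marked [IsProbabilityMeasure P] [mE : MeasurableSpace E] {ν : Measure E}
    (hX : ∀ n, Measurable (X n)) {M : ℕ → Ω → E} (hM : ∀ n, Measurable (M n))
    (hν : ∀ n, P.map (M n) = ν)
    (hind : ∀ n, Indep (mE.comap (M n)) (markedSigma X M n) P)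
    {e : Plane × E → ℝ≥0∞} (he : Measurable e) (n : ℕ) {G : Ω → ℝ≥0∞}
    (hG : Measurable[pointSigma X] G) :
    ∫⁻ ω, G ω * ∏ j ∈ Finset.range n, e (X j ω, M j ω) ∂P =
      ∫⁻ ω, G ω * ∏ j ∈ Finset.range n, (∫⁻ m, e (X j ω, m) ∂ν) ∂P := by
  have : IsProbabilityMeasure ν := by
    rw [← hν 0]; exact Measure.isProbabilityMeasure_map (hM 0).aemeasurable
  have hw : Measurable fun y : Plane => ∫⁻ m, e (y, m) ∂ν := he.lintegral_prod_right'
  induction n generalizing G with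
  | zero => simp
  | succ n ih =>
    have hX𝓐 : ∀ j, Measurable[markedSigma X M n] (X j) := fun j =>
      (measurable_pointSigma X j).mono (pointSigma_le_markedSigma X M n) le_rfl
    have hpast : Measurable[markedSigma X M n] fun ω => G ω * ∏ j ∈ Finset.range n, e (X j ω, M j ω) := by
      refine Measurable.mul (hG.mono (pointSigma_le_markedSigma X M n) le_rfl) (Finset.measurable_prod _ fun j hj => ?_)
      exact he.comp ((hX𝓐 j).prodMk (measurable_markedSigma X M (Finset.mem_range.1 hj)))
    have hH : Measurable[(markedSigma X M n).prod mE] fun q : Ω × E =>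
        (G q.1 * ∏ j ∈ Finset.range n, e (X j q.1, M j q.1)) * e (X n q.1, q.2) :=
      Measurable.mul (hpast.comp measurable_fst)
        (he.comp (((hX𝓐 n).comp measurable_fst).prodMk measurable_snd))
    have step := lintegral_comp_of_indep (markedSigma_le hX hM n) (hM n) (hind n) hH
    simp only at step
    simp_rw [Finset.prod_range_succ, ← mul_assoc]
    rw [step, hν n]
    have h1 : ∀ ω, ∫⁻ m, G ω * (∏ j ∈ Finset.range n, e (X j ω, M j ω)) * e (X n ω, m) ∂ν =
        (G ω * ∫⁻ m, e (X n ω, m) ∂ν) * ∏ j ∈ Finset.range n, e (X j ω, M j ω) := fun ω => by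
      have := he.comp (measurable_prodMk_left (x := X n ω))
      rw [lintegral_const_mul _ (f := fun m => e (X n ω, m)) this]
      ring
    simp_rw [h1]
    -- The averaged last factor depends on the points only, so it is absorbed into `G`; this is why
    -- the induction runs over all `G`.
    rw [ih (G := fun ω => G ω * ∫⁻ m, e (X n ω, m) ∂ν) (Measurable.mul hG (hw.comp (measurable_pointSigma X n)))]
    refine lintegral_congr fun ω => ?_
    ring

/-- The Laplace functional of an independently marked Poisson process. -/
theorem IsPoissonProcess.lintegral_expNeg_tsum_marked [IsProbabilityMeasure P]
    [mE : MeasurableSpace E] {ν : Measure E}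
    (hX : IsPoissonProcess P X lam) (hlam : 0 ≤ lam) {M : ℕ → Ω → E} (hM : ∀ n, Measurable (M n))
    (hν : ∀ n, P.map (M n) = ν)
    (hind : ∀ n, Indep (mE.comap (M n)) (markedSigma X M n) P)
    {v : Plane × E → ℝ≥0∞} (hv : Measurable v) :
    ∫⁻ ω, expNeg (∑' n, v (X n ω, M n ω)) ∂P =
      expNeg (ENNReal.ofReal lam * ∫⁻ y, ∫⁻ m, (1 - expNeg (v (y, m))) ∂ν) := by
  have hνP : IsProbabilityMeasure ν := by
    rw [← hν 0]; exact Measure.isProbabilityMeasure_map (hM 0).aemeasurable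
  have he : Measurable fun q => expNeg (v q) := measurable_expNeg.comp hv
  -- Averaging over the mark leaves a factor `w ≤ 1` per point. It is `expNeg` of the weight `negLog
  -- ∘ w`, so the unmarked formula applies; the weight may be `∞` where `w = 0`.
  let w : Plane → ℝ≥0∞ := fun y => ∫⁻ m, expNeg (v (y, m)) ∂ν
  have hw : Measurable w := he.lintegral_prod_right'
  have hw1 : ∀ y, w y ≤ 1 := fun y => by
    refine (lintegral_mono fun m => expNeg_le_one _).trans ?_
    simp
  have h1 : ∀ n, ∫⁻ ω, expNeg (∑ j ∈ Finset.range n, v (X j ω, M j ω)) ∂P =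
      ∫⁻ ω, expNeg (∑ j ∈ Finset.range n, negLog (w (X j ω))) ∂P := fun n => by
    have := lintegral_mul_prod_marked hX.measurable hM hν hind he n (G := fun _ => 1)
      measurable_const
    simpa only [expNeg_sum, one_mul, expNeg_negLog (hw1 _)] using this
  have hL : Tendsto (fun n => ∫⁻ ω, expNeg (∑ j ∈ Finset.range n, v (X j ω, M j ω)) ∂P) atTop
      (𝓝 (∫⁻ ω, expNeg (∑' j, v (X j ω, M j ω)) ∂P)) :=
    tendsto_lintegral_expNeg (fun n => Finset.measurable_sum _ fun j _ =>
      hv.comp ((hX.measurable j).prodMk (hM j)))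
      (ae_of_all _ fun ω => ENNReal.summable.hasSum.tendsto_sum_nat)
  have hR : Tendsto (fun n => ∫⁻ ω, expNeg (∑ j ∈ Finset.range n, negLog (w (X j ω))) ∂P) atTop
      (𝓝 (∫⁻ ω, expNeg (∑' j, negLog (w (X j ω))) ∂P)) :=
    tendsto_lintegral_expNeg (fun n => Finset.measurable_sum _ fun j _ =>
      measurable_negLog.comp (hw.comp (hX.measurable j)))
      (ae_of_all _ fun ω => ENNReal.summable.hasSum.tendsto_sum_nat)
  simp_rw [h1] at hL
  rw [tendsto_nhds_unique hL hR,
    hX.lintegral_expNeg_tsum hlam (u := fun y => negLog (w y)) (measurable_negLog.comp hw)]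
  congr 2
  refine lintegral_congr fun y => ?_
  rw [expNeg_negLog (hw1 y), lintegral_sub (g := fun m => expNeg (v (y, m))) (he.comp measurable_prodMk_left)
    (ne_top_of_le_ne_top (by simp) (hw1 y)) (ae_of_all _ fun m => expNeg_le_one _)]
  simp [w]

end

/-! ### Polar coordinates, exponential gains and the path-loss integral. -/

section

/-- Polar coordinates in the plane, in terms of the squared radius. -/
lemma lintegral_norm_sq {f : ℝ → ℝ≥0∞} (hf : Measurable f) :
    ∫⁻ y : Plane, f (‖y‖ ^ 2) = ENNReal.ofReal Real.pi * ∫⁻ v in Ioi (0 : ℝ), f v := by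
  have hm : Measurable fun y : Plane => ‖y‖ ^ 2 := by fun_prop
  have key : Measure.map (fun y : Plane => ‖y‖ ^ 2) volume =
      ENNReal.ofReal Real.pi • volume.restrict (Ioi (0 : ℝ)) := by
    -- A disc of squared radius `b` has area `π b`. Differences of these finite values give the
    -- half-open intervals, which determine both measures.
    have hL : ∀ b : ℝ, Measure.map (fun y : Plane => ‖y‖ ^ 2) volume (Iic b) =
        ENNReal.ofReal b * ENNReal.ofReal Real.pi := by
      intro b
      rw [Measure.map_apply hm measurableSet_Iic]
      rcases lt_or_ge b 0 with hb | hb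
      · rw [ENNReal.ofReal_of_nonpos hb.le, zero_mul]
        convert measure_empty (μ := (volume : Measure Plane))
        ext y
        simpa using hb.trans_le (sq_nonneg ‖y‖)
      · have : (fun y : Plane => ‖y‖ ^ 2) ⁻¹' Iic b = Metric.closedBall 0 (Real.sqrt b) := by
          ext y
          rw [mem_closedBall_zero_iff]
          exact (Real.le_sqrt (norm_nonneg y) hb).symm
        rw [this, EuclideanSpace.volume_closedBall_fin_two, ← ENNReal.ofReal_pow (Real.sqrt_nonneg b),
          Real.sq_sqrt hb]
    have hR : ∀ b : ℝ, (ENNReal.ofReal Real.pi • volume.restrict (Ioi (0 : ℝ))) (Iic b) =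
        ENNReal.ofReal b * ENNReal.ofReal Real.pi := by
      intro b
      rw [Measure.smul_apply, Measure.restrict_apply measurableSet_Iic, inter_comm, Ioi_inter_Iic,
        Real.volume_Ioc, sub_zero, smul_eq_mul, mul_comm]
    have hdiff : ∀ (μ : Measure ℝ), (∀ b : ℝ, μ (Iic b) =
        ENNReal.ofReal b * ENNReal.ofReal Real.pi) → ∀ a b, a < b → μ (Ioc a b) =
          ENNReal.ofReal b * ENNReal.ofReal Real.pi - ENNReal.ofReal a * ENNReal.ofReal Real.pi := by
      intro μ hμ a b hab
      rw [← Iic_sdiff_Iic, measure_sdiff (Iic_subset_Iic.2 hab.le) nullMeasurableSet_Iic, hμ, hμ]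
      rw [hμ]
      exact ENNReal.mul_ne_top (by simp) (by simp)
    refine Measure.ext_of_Ioc' _ _ (fun a b hab => ?_) (fun a b hab => ?_)
    · rw [hdiff _ hL a b hab]
      exact ne_top_of_le_ne_top (ENNReal.mul_ne_top (by simp) (by simp)) tsub_le_self
    · rw [hdiff _ hL a b hab, hdiff _ hR a b hab]
  rw [← lintegral_map hf hm, key, lintegral_smul_measure, smul_eq_mul]

lemma lintegral_Ioi_mul_left {c : ℝ} (hc : 0 < c) (b : ℝ) {f : ℝ → ℝ≥0∞} (hf : Measurable f) :
    ∫⁻ v in Ioi (c * b), f v = ENNReal.ofReal c * ∫⁻ u in Ioi b, f (c * u) := by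
  rw [← lintegral_indicator measurableSet_Ioi, ← lintegral_indicator measurableSet_Ioi]
  conv_lhs => rw [← Real.smul_map_volume_mul_left hc.ne', abs_of_pos hc]
  rw [lintegral_smul_measure, smul_eq_mul,
    lintegral_map (hf.indicator measurableSet_Ioi) (measurable_const_mul c)]
  congr 1
  refine lintegral_congr fun u => ?_
  simp only [indicator, mem_Ioi, mul_lt_mul_iff_right₀ hc]

lemma lintegral_expMeasure {r : ℝ} {f : ℝ → ℝ≥0∞} (hf : Measurable f) :
    ∫⁻ h, f h ∂(expMeasure r) = ∫⁻ h, exponentialPDF r h * f h := by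
  have hm : Measurable (gammaPDF 1 r) := (measurable_gammaPDFReal 1 r).ennreal_ofReal
  rw [expMeasure, gammaMeasure, lintegral_withDensity_eq_lintegral_mul _ hm hf]
  rfl

instance : IsProbabilityMeasure (expMeasure 1) := isProbabilityMeasure_expMeasure one_pos

lemma expMeasure_ae_pos : ∀ᵐ h ∂(expMeasure 1), 0 < h := by
  rw [ae_iff]
  have : {a : ℝ | ¬ 0 < a} = Iic 0 := by ext; simp
  rw [this, ← ofReal_cdf, cdf_expMeasure_eq one_pos]
  simp

/-- The Laplace transform of an exponential variable of unit mean. -/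
lemma lintegral_expNeg_expMeasure {a : ℝ} (ha : 0 ≤ a) :
    ∫⁻ h, expNeg (ENNReal.ofReal (a * h)) ∂(expMeasure 1) = ENNReal.ofReal (1 / (1 + a)) := by
  rw [lintegral_expMeasure (by fun_prop)]
  have h1 : ∀ h : ℝ, exponentialPDF 1 h * expNeg (ENNReal.ofReal (a * h)) =
      ENNReal.ofReal (1 / (1 + a)) * exponentialPDF (1 + a) h := by
    intro h
    rcases lt_or_ge h 0 with hh | hh
    · simp [exponentialPDF_of_neg hh]
    · rw [exponentialPDF_of_nonneg hh, exponentialPDF_of_nonneg hh, expNeg_ofReal (by positivity),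
        ← ENNReal.ofReal_mul (by positivity), ← ENNReal.ofReal_mul (by positivity), one_mul,
        ← Real.exp_add, ← mul_assoc, one_div_mul_cancel (by positivity), one_mul]
      congr 2; ring_nf
  simp_rw [h1]
  rw [lintegral_const_mul' _ _ (by simp), lintegral_exponentialPDF_eq_one (by positivity), mul_one]

/-- The threshold is extended because it will be built from the interference; at `∞` both sides
vanish. -/
lemma expMeasure_Ioi (a : ℝ≥0∞) : expMeasure 1 {h | a < ENNReal.ofReal h} = expNeg a := by
  by_cases ha : a = ∞
  · simp [ha]
  have : {h : ℝ | a < ENNReal.ofReal h} = (Iic a.toReal)ᶜ := by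
    ext h
    simp [ENNReal.lt_ofReal_iff_toReal_lt ha]
  rw [this, measure_compl measurableSet_Iic (measure_ne_top _ _), measure_univ, ← ofReal_cdf,
    cdf_expMeasure_eq one_pos, if_pos ENNReal.toReal_nonneg, expNeg_eq_ofReal_exp ha, one_mul,
    ← ENNReal.ofReal_one, ← ENNReal.ofReal_sub _ (by simp)]
  congr 1; ring

section PathLoss

variable {α : ℝ}

lemma integrableOn_one_div_one_add_rpow (hα : 2 < α) {b : ℝ} (hb : 0 ≤ b) :
    IntegrableOn (fun v : ℝ => 1 / (1 + v ^ (α / 2))) (Ioi b) := by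
  have hmeas : Measurable fun v : ℝ => 1 / (1 + v ^ (α / 2)) := by fun_prop
  have h0 : IntegrableOn (fun v : ℝ => 1 / (1 + v ^ (α / 2))) (Ioi 0) := by
    rw [← Ioc_union_Ioi_eq_Ioi zero_le_one]
    refine IntegrableOn.union ?_ ?_
    · refine Measure.integrableOn_of_bounded (M := 1) (by simp) hmeas.aestronglyMeasurable ?_
      refine (ae_restrict_iff' measurableSet_Ioc).2 (ae_of_all _ fun v hv => ?_)
      have : 0 ≤ v ^ (α / 2) := Real.rpow_nonneg hv.1.le _
      rw [Real.norm_of_nonneg (by positivity), div_le_one (by positivity)]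
      linarith
    · refine Integrable.mono' (integrableOn_Ioi_rpow_of_lt (a := -(α / 2)) (by linarith) one_pos)
        hmeas.aestronglyMeasurable ?_
      refine (ae_restrict_iff' measurableSet_Ioi).2 (ae_of_all _ fun v hv => ?_)
      have hv0 : (0 : ℝ) < v := one_pos.trans hv
      have : 0 < v ^ (α / 2) := Real.rpow_pos_of_pos hv0 _
      rw [Real.norm_of_nonneg (by positivity), Real.rpow_neg hv0.le, ← one_div]
      exact one_div_le_one_div_of_le this (by linarith)
  exact h0.mono_set (Ioi_subset_Ioi hb)

lemma lintegral_one_div_one_add_rpow (hα : 2 < α) {b : ℝ} (hb : 0 ≤ b) :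
    ∫⁻ v in Ioi b, ENNReal.ofReal (1 / (1 + v ^ (α / 2))) =
      ENNReal.ofReal (∫ v in Ioi b, 1 / (1 + v ^ (α / 2))) := by
  rw [ofReal_integral_eq_lintegral_ofReal (integrableOn_one_div_one_add_rpow hα hb)]
  refine (ae_restrict_iff' measurableSet_Ioi).2 (ae_of_all _ fun v hv => ?_)
  have : 0 ≤ v ^ (α / 2) := Real.rpow_nonneg (hb.trans (le_of_lt hv)) _
  simp only [Pi.zero_apply]
  positivity

lemma rhoInfty_nonneg (α : ℝ) : 0 ≤ rhoInfty α :=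
  setIntegral_nonneg measurableSet_Ioi fun v hv => by
    have : 0 ≤ v ^ (α / 2) := Real.rpow_nonneg (le_of_lt hv) _
    positivity

lemma rho_nonneg (α : ℝ) {β : ℝ} (hβ : 0 ≤ β) : 0 ≤ rho α β :=
  setIntegral_nonneg measurableSet_Ioi fun v hv => by
    have : 0 ≤ v ^ (α / 2) := Real.rpow_nonneg ((Real.rpow_nonneg hβ _).trans (le_of_lt hv)) _
    positivity

/-- The exponent of the Laplace functional of the interference from the points at distance at
least `t`, with gains integrated out. -/
lemma lintegral_pathLoss (hα : 2 < α) {a t : ℝ} (ha : 0 ≤ a) (ht : 0 ≤ t) :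
    ∫⁻ y : Plane, (if t ≤ ‖y‖ then 1 - ENNReal.ofReal (1 / (1 + a * ‖y‖ ^ (-α))) else 0) =
      ENNReal.ofReal (Real.pi * a ^ (2 / α) *
        ∫ v in Ioi (t ^ 2 / a ^ (2 / α)), 1 / (1 + v ^ (α / 2))) := by
  rcases ha.eq_or_lt with rfl | ha
  · have h2 : (0 : ℝ) ^ (2 / α) = 0 := Real.zero_rpow (by positivity)
    simp [h2]
  -- Since `c ^ (α / 2) = a`, dividing the squared radius by `c` removes `a` from the integrand and
  -- puts a factor `c` in front.
  set c := a ^ (2 / α) with hc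
  have hc0 : 0 < c := Real.rpow_pos_of_pos ha _
  have hca : c ^ (α / 2) = a := by
    rw [hc, ← Real.rpow_mul ha.le]
    have : 2 / α * (α / 2) = 1 := by field_simp
    rw [this, Real.rpow_one]
  let f : ℝ → ℝ≥0∞ := fun v =>
    if t ^ 2 ≤ v then 1 - ENNReal.ofReal (1 / (1 + a * v ^ (-(α / 2)))) else 0
  have hf : Measurable f := by
    refine Measurable.ite measurableSet_Ici ?_ measurable_const
    fun_prop
  have h1 : ∀ y : Plane, (if t ≤ ‖y‖ then 1 - ENNReal.ofReal (1 / (1 + a * ‖y‖ ^ (-α))) else 0) =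
      f (‖y‖ ^ 2) := by
    intro y
    have e1 : (‖y‖ ^ 2) ^ (-(α / 2)) = ‖y‖ ^ (-α) := by
      rw [← Real.rpow_natCast, ← Real.rpow_mul (norm_nonneg y)]
      congr 1; push_cast; ring
    simp only [f, e1, sq_le_sq₀ ht (norm_nonneg y)]
  simp_rw [h1]
  rw [lintegral_norm_sq hf]
  let g : ℝ → ℝ≥0∞ := fun v => ENNReal.ofReal (1 / (1 + (v / c) ^ (α / 2)))
  have hg : Measurable g := by fun_prop
  have h2 : ∫⁻ v in Ioi (0 : ℝ), f v = ∫⁻ v in Ioi (t ^ 2), g v := by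
    have hsub : Ioi (t ^ 2) ⊆ Ioi (0 : ℝ) := Ioi_subset_Ioi (by positivity)
    rw [← lintegral_indicator measurableSet_Ioi, ← lintegral_indicator measurableSet_Ioi]
    refine lintegral_congr_ae ?_
    have hne : ∀ᵐ v : ℝ, v ≠ t ^ 2 := by simp [ae_iff]
    filter_upwards [hne] with v hv
    by_cases hvt : t ^ 2 < v
    · have hv0 : 0 < v := hsub hvt
      rw [indicator_of_mem (show v ∈ Ioi 0 from hv0), indicator_of_mem (show v ∈ Ioi (t ^ 2) from hvt)]
      simp only [f, g, if_pos hvt.le]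
      have hp : 0 < v ^ (α / 2) := Real.rpow_pos_of_pos hv0 _
      rw [← ENNReal.ofReal_one, Real.rpow_neg hv0.le, ← ENNReal.ofReal_sub _ (by positivity),
        Real.div_rpow hv0.le hc0.le, hca]
      congr 1
      field_simp
      ring
    · rw [indicator_of_notMem (show v ∉ Ioi (t ^ 2) from hvt)]
      by_cases hv0 : 0 < v
      · rw [indicator_of_mem (show v ∈ Ioi 0 from hv0)]
        simp only [f]
        rw [if_neg]
        intro h
        exact hvt (lt_of_le_of_ne h hv.symm)
      · rw [indicator_of_notMem (show v ∉ Ioi 0 from hv0)]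
  have h3 : t ^ 2 = c * (t ^ 2 / c) := by field_simp
  rw [h2]
  conv_lhs => rw [h3]
  rw [lintegral_Ioi_mul_left hc0 _ hg]
  simp only [g, mul_div_cancel_left₀ _ hc0.ne']
  rw [lintegral_one_div_one_add_rpow hα (by positivity), ← ENNReal.ofReal_mul hc0.le,
    ← ENNReal.ofReal_mul Real.pi_pos.le, mul_assoc]

end PathLoss

end

/-! ### Void probabilities and general position. -/

section

variable {Ω : Type*} [MeasurableSpace Ω] {P : Measure Ω} {X : ℕ → Ω → Plane} {lam : ℝ}

/-- One point of infinite weight makes the whole sum infinite. This is what turns void events into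
Laplace functionals. -/
lemma ite_forall_notMem_eq_expNeg {ι E : Type*} (A : Set E) [DecidablePred (· ∈ A)] (z : ι → E)
    [Decidable (∀ n, z n ∉ A)] :
    (if ∀ n, z n ∉ A then (1 : ℝ≥0∞) else 0) = expNeg (∑' n, if z n ∈ A then ∞ else 0) := by
  split_ifs with h
  · simp [h]
  · push Not at h
    obtain ⟨n, hn⟩ := h
    symm
    rw [expNeg_eq_zero, ← top_le_iff]
    refine le_trans ?_ (ENNReal.le_tsum n)
    simp [hn]

lemma measurableSet_void (hX : ∀ n, Measurable (X n)) {A : Set Plane} (hA : MeasurableSet A) :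
    MeasurableSet {ω | ∀ n, X n ω ∉ A} := by
  have : {ω | ∀ n, X n ω ∉ A} = ⋂ n, (X n ⁻¹' A)ᶜ := by ext; simp
  rw [this]
  exact MeasurableSet.iInter fun n => (hX n hA).compl

/-- The void probabilities of a Poisson process. -/
lemma IsPoissonProcess.void_probability [IsProbabilityMeasure P] (hX : IsPoissonProcess P X lam)
    (hlam : 0 ≤ lam) {A : Set Plane} (hA : MeasurableSet A) :
    P {ω | ∀ n, X n ω ∉ A} = expNeg (ENNReal.ofReal lam * volume A) := by
  classical
  have hu : Measurable fun y : Plane => if y ∈ A then ∞ else 0 :=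
    Measurable.ite hA measurable_const measurable_const
  have hS := measurableSet_void hX.measurable hA
  have key := hX.lintegral_expNeg_tsum hlam hu
  simp_rw [← ite_forall_notMem_eq_expNeg] at key
  have h1 : ∀ y : Plane, 1 - expNeg (if y ∈ A then ∞ else 0) = A.indicator 1 y := fun y => by
    by_cases hy : y ∈ A <;> simp [hy]
  have h2 : ∀ ω, (if ∀ n, X n ω ∉ A then (1 : ℝ≥0∞) else 0) =
      {ω | ∀ n, X n ω ∉ A}.indicator 1 ω := fun ω => by simp [indicator]
  simp_rw [h1, h2] at key
  rwa [lintegral_indicator_one hA, lintegral_indicator_one hS] at key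

lemma IsPoissonProcess.ae_notMem [IsProbabilityMeasure P] (hX : IsPoissonProcess P X lam)
    (hlam : 0 ≤ lam) {A : Set Plane} (hA : MeasurableSet A) (hA' : volume A = 0) :
    ∀ᵐ ω ∂P, ∀ n, X n ω ∉ A := by
  have h : P {ω | ∀ n, X n ω ∉ A} = 1 := by simp [hX.void_probability hlam hA, hA']
  exact (mem_ae_iff_prob_eq_one (measurableSet_void hX.measurable hA)).2 h

lemma IsPoissonProcess.ae_finite [IsProbabilityMeasure P] (hX : IsPoissonProcess P X lam) :
    ∀ᵐ ω ∂P, ∀ R : ℝ, {n | ‖X n ω‖ < R}.Finite := by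
  have h1 : ∀ K : ℕ, ∀ᵐ ω ∂P, {n | ‖X n ω‖ < K}.Finite := by
    intro K
    have hA : MeasurableSet (Metric.ball (0 : Plane) K) := Metric.isOpen_ball.measurableSet
    have hm := measurable_count hX.measurable hA
    have : ∀ᵐ j ∂(P.map (count X (Metric.ball (0 : Plane) K))), j ≠ ⊤ := by
      rw [hX.map_count hA measure_ball_lt_top]
      refine (ae_map_iff (measurable_of_countable _).aemeasurable .of_discrete).2 ?_
      exact ae_of_all _ fun j => ENat.natCast_ne_top j
    filter_upwards [ae_of_ae_map hm.aemeasurable this] with ω hω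
    rw [count, ne_eq, Set.encard_eq_top_iff, Set.not_infinite] at hω
    simpa using hω
  filter_upwards [ae_all_iff.2 h1] with ω hω R
  obtain ⟨K, hK⟩ := exists_nat_gt R
  exact (hω K).subset fun n hn => lt_trans hn hK

/-- With mean `m` the probability is `1 - exp (-m) (1 + m)`, at most `m ^ 2` because `exp (-m) ≥ 1 -
m`. The quadratic order beats the number of cells when the plane is cut into thin annuli. -/
lemma IsPoissonProcess.measure_two_le_count [IsProbabilityMeasure P]
    (hX : IsPoissonProcess P X lam) (hlam : 0 ≤ lam) {A : Set Plane} (hA : MeasurableSet A)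
    (hA' : volume A < ∞) :
    P {ω | 2 ≤ count X A ω} ≤ ENNReal.ofReal ((lam * (volume A).toReal) ^ 2) := by
  have hm := measurable_count hX.measurable hA
  set m := lam * (volume A).toReal with hmdef
  have hm0 : 0 ≤ m := by positivity
  have h0 : MeasurableSet {ω | count X A ω = (0 : ℕ)} := hm (measurableSet_singleton _)
  have h1 : MeasurableSet {ω | count X A ω = (1 : ℕ)} := hm (measurableSet_singleton _)
  have hd : Disjoint {ω | count X A ω = (0 : ℕ)} {ω | count X A ω = (1 : ℕ)} := by
    refine Set.disjoint_left.2 fun ω (a : _ = _) (b : _ = _) => ?_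
    rw [a] at b
    simp at b
  have hsub : {ω | 2 ≤ count X A ω} ⊆
      ({ω | count X A ω = (0 : ℕ)} ∪ {ω | count X A ω = (1 : ℕ)})ᶜ := by
    rintro ω hω (h | h) <;> rw [mem_ofPred_eq] at hω h <;> rw [h] at hω <;> norm_num at hω
  refine (measure_mono hsub).trans ?_
  rw [measure_compl (h0.union h1) (measure_ne_top _ _), measure_union hd h1, hX.count_law A hA hA',
    hX.count_law A hA hA', poissonMeasure_singleton, poissonMeasure_singleton, ← hmdef,
    Real.coe_toNNReal _ hm0, measure_univ, ← ENNReal.ofReal_add (by positivity) (by positivity),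
    ← ENNReal.ofReal_one, ← ENNReal.ofReal_sub _ (by positivity)]
  refine ENNReal.ofReal_le_ofReal ?_
  have := Real.add_one_le_exp (-m)
  simp only [pow_zero, pow_one, Nat.factorial_zero, Nat.factorial_one, Nat.cast_one, div_one, mul_one]
  nlinarith

lemma volume_sq_annulus (a b : ℝ) (ha : 0 ≤ a) :
    volume {y : Plane | a ≤ ‖y‖ ^ 2 ∧ ‖y‖ ^ 2 < b} = ENNReal.ofReal (Real.pi * (b - a)) := by
  have hm : Measurable fun y : Plane => ‖y‖ ^ 2 := by fun_prop
  have h := lintegral_norm_sq (f := (Ico a b).indicator 1) (measurable_one.indicator measurableSet_Ico)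
  have e : (fun y : Plane => (Ico a b).indicator (1 : ℝ → ℝ≥0∞) (‖y‖ ^ 2)) =
      {y : Plane | a ≤ ‖y‖ ^ 2 ∧ ‖y‖ ^ 2 < b}.indicator 1 := rfl
  have hS : MeasurableSet {y : Plane | a ≤ ‖y‖ ^ 2 ∧ ‖y‖ ^ 2 < b} := hm measurableSet_Ico
  rw [e, lintegral_indicator_one hS, lintegral_indicator_one measurableSet_Ico,
    Measure.restrict_apply measurableSet_Ico] at h
  rw [h, ENNReal.ofReal_mul Real.pi_pos.le]
  congr 1
  have hae : (Ico a b ∩ Ioi 0 : Set ℝ) =ᵐ[volume] (Ioo a b : Set ℝ) := by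
    have h0 : ∀ᵐ v : ℝ, v ≠ a := by simp [ae_iff]
    filter_upwards [h0] with v hv
    refine propext ⟨fun ⟨h1, _⟩ => ⟨lt_of_le_of_ne h1.1 hv.symm, h1.2⟩,
      fun h1 => ⟨⟨h1.1.le, h1.2⟩, ha.trans_lt h1.1⟩⟩
  rw [measure_congr hae, Real.volume_Ioo]

/-- Almost surely, no two points of a Poisson process are at the same distance from the origin. -/
lemma IsPoissonProcess.ae_norm_injective [IsProbabilityMeasure P] (hX : IsPoissonProcess P X lam)
    (hlam : 0 ≤ lam) : ∀ᵐ ω ∂P, ∀ i j, ‖X i ω‖ = ‖X j ω‖ → i = j := by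
  have hR : ∀ R : ℕ, ∀ᵐ ω ∂P, ∀ i j, ‖X i ω‖ = ‖X j ω‖ → ‖X i ω‖ ^ 2 < R → i = j := by
    intro R
    let C := lam * (Real.pi * R)
    let A : ℕ → ℕ → Set Plane := fun N k =>
      {y : Plane | R * k / (N + 1) ≤ ‖y‖ ^ 2 ∧ ‖y‖ ^ 2 < R * (k + 1) / (N + 1)}
    have hA : ∀ N k, MeasurableSet (A N k) := fun N k => by
      have hm : Measurable fun y : Plane => ‖y‖ ^ 2 := by fun_prop
      exact hm (measurableSet_Ico (a := (R * k / (N + 1) : ℝ)) (b := R * (k + 1) / (N + 1)))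
    have hvol : ∀ N k, volume (A N k) = ENNReal.ofReal (Real.pi * R / (N + 1)) := fun N k => by
      rw [volume_sq_annulus _ _ (by positivity)]
      congr 1
      field_simp
      ring
    -- The disc of squared radius `R` is cut into `N + 1` annuli of equal area. Two points at the
    -- same distance share an annulus, and each annulus has mean `C / (N + 1)`, so the union bound
    -- is `(N + 1) (C / (N + 1)) ^ 2`.
    have hbound : ∀ N : ℕ, P {ω | ¬ ∀ i j, ‖X i ω‖ = ‖X j ω‖ → ‖X i ω‖ ^ 2 < R → i = j} ≤
        ENNReal.ofReal (C ^ 2 / (N + 1)) := by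
      intro N
      have hN : (0 : ℝ) < N + 1 := by positivity
      have hsub : {ω | ¬ ∀ i j, ‖X i ω‖ = ‖X j ω‖ → ‖X i ω‖ ^ 2 < R → i = j} ⊆
          ⋃ k ∈ Finset.range (N + 1), {ω | 2 ≤ count X (A N k) ω} := by
        intro ω hω
        rw [mem_ofPred_eq] at hω
        push Not at hω
        obtain ⟨i, j, hij, hiR, hne⟩ := hω
        have hR0 : (0 : ℝ) < R := (sq_nonneg _).trans_lt hiR
        set q := ‖X i ω‖ ^ 2 * (N + 1) / R with hq
        have hq0 : 0 ≤ q := by positivity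
        have hk1 := Nat.floor_le hq0
        have hk2 := Nat.lt_floor_add_one q
        have hqN : q < N + 1 := by
          rw [hq, div_lt_iff₀ hR0, mul_comm]
          exact mul_lt_mul_of_pos_left hiR hN
        refine mem_biUnion (x := ⌊q⌋₊) ?_ ?_
        · rw [Finset.mem_coe, Finset.mem_range, Nat.floor_lt hq0]
          exact_mod_cast hqN
        · have hmem : X i ω ∈ A N ⌊q⌋₊ := by
            have e : ‖X i ω‖ ^ 2 = R * q / (N + 1) := by rw [hq]; field_simp
            constructor
            · rw [e]; gcongr
            · rw [e]; gcongr
          have hmem' : X j ω ∈ A N ⌊q⌋₊ := by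
            have := hmem
            simp only [A, mem_ofPred_eq, hij] at this
            exact this
          rw [mem_ofPred_eq, count, ← Set.encard_pair hne]
          refine Set.encard_le_encard ?_
          rintro n (rfl | rfl)
          · exact hmem
          · exact hmem'
      refine (measure_mono hsub).trans ((measure_biUnion_finset_le _ _).trans ?_)
      have hle : ∀ k ∈ Finset.range (N + 1), P {ω | 2 ≤ count X (A N k) ω} ≤
          ENNReal.ofReal ((C / (N + 1)) ^ 2) := fun k _ => by
        refine (hX.measure_two_le_count hlam (hA N k) (by rw [hvol]; simp)).trans_eq ?_
        rw [hvol, ENNReal.toReal_ofReal (by positivity)]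
        congr 2
        simp only [C]; ring
      refine (Finset.sum_le_sum hle).trans_eq ?_
      rw [Finset.sum_const, Finset.card_range, nsmul_eq_mul, ← ENNReal.ofReal_natCast,
        ← ENNReal.ofReal_mul (by positivity)]
      congr 1
      push_cast
      field_simp
    rw [ae_iff]
    have hlim : Tendsto (fun N : ℕ => ENNReal.ofReal (C ^ 2 / (N + 1))) atTop (𝓝 0) := by
      rw [← ENNReal.ofReal_zero]
      refine ENNReal.tendsto_ofReal ?_
      have := (tendsto_one_div_add_atTop_nhds_zero_nat (𝕜 := ℝ)).const_mul (C ^ 2)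
      simpa [div_eq_mul_inv] using this
    exact le_antisymm (ge_of_tendsto' hlim hbound) zero_le
  filter_upwards [ae_all_iff.2 hR] with ω hω i j hij
  obtain ⟨K, hK⟩ := exists_nat_gt (‖X i ω‖ ^ 2)
  exact hω K i j hij hK

end

/-! ### Tail and moment of the power of a buyer station. -/

section

lemma indep_of_le_iSup {Ω ι : Type*} {m : ι → MeasurableSpace Ω} {mΩ : MeasurableSpace Ω}
    {P : Measure Ω} (hle : ∀ i, m i ≤ mΩ) (hm : iIndep m P) {S T : Set ι} (hST : Disjoint S T)
    {m₁ m₂ : MeasurableSpace Ω} (h₁ : m₁ ≤ ⨆ i ∈ S, m i) (h₂ : m₂ ≤ ⨆ i ∈ T, m i) :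
    Indep m₁ m₂ P :=
  indep_of_indep_of_le (indep_iSup_of_disjoint hle hm hST) h₁ h₂

lemma markedSigma_le_of_le {Ω E : Type*} [mE : MeasurableSpace E] {X : ℕ → Ω → Plane}
    {M : ℕ → Ω → E} {n : ℕ} {𝓐 : MeasurableSpace Ω} (hX : pointSigma X ≤ 𝓐)
    (hM : ∀ j < n, mE.comap (M j) ≤ 𝓐) : markedSigma X M n ≤ 𝓐 :=
  sup_le hX (iSup₂_le fun j hj => hM j hj)

variable {MNO Band Ω : Type*} [DecidableEq MNO] [MeasurableSpace Ω] {P : Measure Ω}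
  {N : Network MNO Band} {F : Randomness MNO Band Ω} {s : MNO} {l : Band}
  {x : Plane}

lemma ae_pos_of_map_eq_expMeasure {h : Ω → ℝ} (hm : Measurable h)
    (hlaw : P.map h = expMeasure 1) : ∀ᵐ ω ∂P, 0 < h ω :=
  ae_of_ae_map (p := fun h => 0 < h) hm.aemeasurable (by rw [hlaw]; exact expMeasure_ae_pos)

/-- The user positions and the earlier gains are sources other than gain `n`. This is the hypothesis
on marks in the marked Laplace functional. -/
lemma IsModel.ueGain_indep (hF : IsModel P N F s l x) (n : ℕ) :
    Indep (MeasurableSpace.comap (F.ueGain l n) inferInstance)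
      (markedSigma (F.ue s) (F.ueGain l) n) P := by
  have hle : ∀ i, UESource.sigma F s l i ≤ ‹MeasurableSpace Ω› := by
    rintro (_ | i)
    · exact pointSigma_le hF.ue_poisson.measurable
    · exact (hF.ueGain_measurable i).comap_le
  have hsub : ∀ {T : Set UESource} {i}, i ∈ T →
      UESource.sigma F s l i ≤ ⨆ i ∈ T, UESource.sigma F s l i := fun {T i} hi =>
    le_iSup₂ (f := fun i (_ : i ∈ T) => UESource.sigma F s l i) i hi
  refine indep_of_le_iSup hle hF.ue_indep (S := {.gain n}) (T := {.gain n}ᶜ)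
    disjoint_compl_right (hsub (i := .gain n) rfl) (markedSigma_le_of_le (hsub (i := .ue) ?_)
      fun j hj => hsub (i := .gain j) ?_)
  · simp
  · simpa using hj.ne

lemma measurable_maxGain (hF : IsModel P N F s l x) : Measurable (maxGain N F s l x) := by
  refine Measurable.iSup fun i => (hF.ueGain_measurable i).mul ?_
  exact ((measurable_const.sub (hF.ue_poisson.measurable i)).norm).pow_const _

lemma measurable_buyerPower (hF : IsModel P N F s l x) : Measurable (buyerPower N F s l x) :=
  (measurable_maxGain hF).const_div _

lemma ae_buyerPower_nonneg (hF : IsModel P N F s l x) (hζ : 0 ≤ N.threshold s) :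
    ∀ᵐ ω ∂P, 0 ≤ buyerPower N F s l x ω := by
  have h := ae_all_iff.2 fun i =>
    ae_pos_of_map_eq_expMeasure (hF.ueGain_measurable i) (hF.ueGain_law i)
  filter_upwards [h] with ω hω
  exact div_nonneg hζ (Real.iSup_nonneg fun i =>
    mul_nonneg (hω i).le (Real.rpow_nonneg (norm_nonneg _) _))

variable [IsProbabilityMeasure P]

/-- The tail of the power of a buyer BS. -/
lemma measure_lt_buyerPower_le (hF : IsModel P N F s l x) (hμ : 0 ≤ N.ueIntensity s)
    (hζ : 0 < N.threshold s) {u : ℝ} (hu : 0 < u) :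
    P {ω | u < buyerPower N F s l x ω} ≤
      expNeg (ENNReal.ofReal (N.ueIntensity s *
        (Real.exp (-1) * (Real.pi * (u / N.threshold s) ^ (2 / N.α))))) := by
  classical
  have hα := N.two_lt_α
  set T := N.threshold s / u with hT
  have hT0 : 0 < T := div_pos hζ hu
  -- With this weight, `expNeg` of the sum is the indicator that no user has received gain above
  -- `T`, which is necessary for the power to exceed `u`.
  let v : Plane × ℝ → ℝ≥0∞ := fun q => if T < q.2 * ‖x - q.1‖ ^ (-N.α) then ∞ else 0
  have hS : MeasurableSet {q : Plane × ℝ | T < q.2 * ‖x - q.1‖ ^ (-N.α)} :=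
    measurableSet_lt measurable_const
      (measurable_snd.mul ((measurable_const.sub measurable_fst).norm.pow_const _))
  have hv : Measurable v := Measurable.ite hS measurable_const measurable_const
  have key := hF.ue_poisson.lintegral_expNeg_tsum_marked hμ hF.ueGain_measurable hF.ueGain_law
    hF.ueGain_indep hv
  have h1 : P {ω | u < buyerPower N F s l x ω} ≤
      ∫⁻ ω, expNeg (∑' n, v (F.ue s n ω, F.ueGain l n ω)) ∂P := by
    have hmeas : MeasurableSet {ω | u < buyerPower N F s l x ω} :=
      measurableSet_lt measurable_const (measurable_buyerPower hF)
    rw [← lintegral_indicator_one hmeas]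
    refine lintegral_mono fun ω => ?_
    by_cases hω : u < buyerPower N F s l x ω
    · rw [indicator_of_mem (by exact hω), Pi.one_apply]
      have hlt := hω
      rw [buyerPower] at hlt
      set H := maxGain N F s l x ω with hH
      -- An unbounded real supremum is `0`, and so is a quotient by `0`; a power above `u > 0`
      -- therefore forces `H > 0`, and with it a bounded family.
      have hH0 : 0 < H := by
        by_contra hle
        exact absurd (hu.trans hlt) (not_lt.2 (div_nonpos_of_nonneg_of_nonpos hζ.le (not_lt.1 hle)))
      have hHT : H < T := by rw [hT, lt_div_iff₀ hu]; rw [lt_div_iff₀ hH0] at hlt; linarith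
      have hbdd : BddAbove (range fun i : ℕ => F.ueGain l i ω * ‖x - F.ue s i ω‖ ^ (-N.α)) := by
        by_contra hb
        exact hH0.ne' (hH.trans (Real.iSup_of_not_bddAbove hb))
      have hall : ∀ i, v (F.ue s i ω, F.ueGain l i ω) = 0 := fun i =>
        if_neg (not_lt.2 ((le_ciSup hbdd i).trans hHT.le))
      simp [hall]
    · rw [indicator_of_notMem (by exact hω)]; exact zero_le
  refine h1.trans (key.trans_le (expNeg_antitone ?_))
  rw [ENNReal.ofReal_mul hμ]
  gcongr
  -- At distance `δ` the path loss equals `T`. In the lower bound of the exponent only users within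
  -- `δ` and with gain above `1`, of probability `exp (-1)`, are kept; the area of the disc supplies
  -- the power `2 / α`.
  set δ := (u / N.threshold s) ^ (1 / N.α) with hδ
  have hq0 : 0 < u / N.threshold s := div_pos hu hζ
  have hδ0 : 0 < δ := Real.rpow_pos_of_pos hq0 _
  have hδα : δ ^ (-N.α) = T := by
    rw [hδ, ← Real.rpow_mul hq0.le]
    have : 1 / N.α * -N.α = -1 := by field_simp
    rw [this, Real.rpow_neg_one, hT, inv_div]
  have hδ2 : δ ^ 2 = (u / N.threshold s) ^ (2 / N.α) := by
    rw [hδ, ← Real.rpow_natCast, ← Real.rpow_mul hq0.le]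
    congr 1
    push_cast
    ring
  have hball : ENNReal.ofReal (Real.exp (-1) * (Real.pi * (u / N.threshold s) ^ (2 / N.α))) =
      ∫⁻ y in Metric.closedBall x δ, ENNReal.ofReal (Real.exp (-1)) := by
    rw [setLIntegral_const, EuclideanSpace.volume_closedBall_fin_two, ← ENNReal.ofReal_pow hδ0.le,
      ← ENNReal.ofReal_mul (by positivity), ← ENNReal.ofReal_mul (by positivity), hδ2]
    congr 1
    ring
  rw [hball, ← lintegral_indicator Metric.isClosed_closedBall.measurableSet]
  -- At `y = x` the convention `0 ^ (-α) = 0` breaks the lower bound on the path loss.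
  have hne : ∀ᵐ y : Plane, y ≠ x := by simp [ae_iff]
  refine lintegral_mono_ae ?_
  filter_upwards [hne] with y hy
  by_cases hyb : y ∈ Metric.closedBall x δ
  · rw [indicator_of_mem hyb]
    have hd0 : 0 < ‖x - y‖ := norm_pos_iff.2 (sub_ne_zero.2 hy.symm)
    have hd : ‖x - y‖ ≤ δ := by rwa [← dist_eq_norm, dist_comm]
    have hg : T ≤ ‖x - y‖ ^ (-N.α) := by
      rw [← hδα]
      exact Real.rpow_le_rpow_of_nonpos hd0 hd (by linarith)
    have h2 : expNeg 1 = ENNReal.ofReal (Real.exp (-1)) := by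
      rw [← ENNReal.ofReal_one, expNeg_ofReal zero_le_one]
    rw [← h2, ← expMeasure_Ioi, ← lintegral_indicator_one]
    · refine lintegral_mono fun h => ?_
      by_cases hh : 1 < ENNReal.ofReal h
      · have hh1 : 1 < h := by simpa using hh
        have : T < h * ‖x - y‖ ^ (-N.α) := by nlinarith
        rw [indicator_of_mem (by exact hh)]
        simp [v, this]
      · rw [indicator_of_notMem (by exact hh)]; exact zero_le
    · exact measurableSet_lt measurable_const ENNReal.measurable_ofReal
  · rw [indicator_of_notMem hyb]; exact zero_le

/-- The moment of order `2 / α` of the power of a buyer BS is finite. -/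
theorem integrable_buyerPower_rpow (hF : IsModel P N F s l x) (hμ : 0 < N.ueIntensity s)
    (hζ : 0 < N.threshold s) :
    Integrable (fun ω => buyerPower N F s l x ω ^ (2 / N.α)) P := by
  have hα := N.two_lt_α
  have hnn := ae_buyerPower_nonneg hF hζ.le
  have hmeas : Measurable fun ω => buyerPower N F s l x ω ^ (2 / N.α) :=
    (measurable_buyerPower hF).pow_const _
  have hnn' : 0 ≤ᵐ[P] fun ω => buyerPower N F s l x ω ^ (2 / N.α) := by
    filter_upwards [hnn] with ω hω using Real.rpow_nonneg hω _
  rw [← lintegral_ofReal_ne_top_iff_integrable hmeas.aestronglyMeasurable hnn',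
    lintegral_eq_lintegral_meas_lt P hnn' hmeas.aemeasurable]
  set c := N.ueIntensity s * (Real.exp (-1) * (Real.pi / N.threshold s ^ (2 / N.α))) with hc
  have hc0 : 0 < c := by positivity
  -- At the level `u = w ^ (α / 2)` the tail bound becomes `exp (-c w)`, which is integrable in the
  -- layer-cake formula.
  have hbound : ∀ w ∈ Ioi (0 : ℝ), P {ω | w < buyerPower N F s l x ω ^ (2 / N.α)} ≤
      ENNReal.ofReal (Real.exp (-c * w)) := by
    intro w hw
    have hw0 : (0 : ℝ) < w := hw
    set u := w ^ (N.α / 2) with hu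
    have hu0 : 0 < u := Real.rpow_pos_of_pos hw0 _
    have huw : u ^ (2 / N.α) = w := by
      rw [hu, ← Real.rpow_mul hw0.le]
      have : N.α / 2 * (2 / N.α) = 1 := by field_simp
      rw [this, Real.rpow_one]
    have h1 : P {ω | w < buyerPower N F s l x ω ^ (2 / N.α)} ≤
        P {ω | u < buyerPower N F s l x ω} := by
      refine measure_mono_ae ?_
      filter_upwards [hnn] with ω hω h
      have h' : w < buyerPower N F s l x ω ^ (2 / N.α) := h
      rw [← huw] at h'
      exact (Real.rpow_lt_rpow_iff hu0.le hω (by positivity)).1 h'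
    refine h1.trans ((measure_lt_buyerPower_le hF hμ.le hζ hu0).trans_eq ?_)
    rw [expNeg_ofReal (by positivity), Real.div_rpow hu0.le hζ.le, huw]
    congr 2
    rw [hc]; ring
  refine ne_top_of_le_ne_top ?_ (setLIntegral_mono' measurableSet_Ioi hbound)
  exact (Integrable.lintegral_lt_top (exp_neg_integrableOn_Ioi 0 hc0)).ne

end

/-! ### Independence between operators, marks and exponents. -/

section

variable {MNO Band Ω : Type*} [DecidableEq MNO] {N : Network MNO Band} {F : Randomness MNO Band Ω}
  {s : MNO} {l : Band} {x : Plane}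

/-- The MNO to which a source of randomness belongs. -/
def Source.mno : Source N s l → MNO
  | .bs k => k
  | .gain k _ => k
  | .power k _ => k

/-- The σ-algebra of all the randomness that belongs to an MNO. -/
@[reducible] def mnoSigma (N : Network MNO Band) (F : Randomness MNO Band Ω) (s : MNO) (l : Band)
    (k : MNO) : MeasurableSpace Ω :=
  ⨆ i ∈ {i : Source N s l | i.mno = k}, Source.sigma F i

lemma Source.sigma_le_iSup {T : Set (Source N s l)} {i : Source N s l} (hi : i ∈ T) :
    Source.sigma F i ≤ ⨆ i ∈ T, Source.sigma F i :=
  le_iSup₂ (f := fun i (_ : i ∈ T) => Source.sigma F i) i hi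

/-- The marks of the BSs of a buyer: transmit power and gain. -/
def buyerMark (F : Randomness MNO Band Ω) (l : Band) (b : MNO) (n : ℕ) (ω : Ω) : ℝ × ℝ :=
  (F.power l b n ω, F.gain l b n ω)

lemma measurable_bs_mnoSigma {k : MNO} (hk : k ∈ N.group l) (n : ℕ) :
    Measurable[mnoSigma N F s l k] (F.bs k n) :=
  (measurable_pointSigma (F.bs k) n).mono
    (Source.sigma_le_iSup (i := (.bs ⟨k, hk⟩ : Source N s l)) rfl) le_rfl

lemma measurable_gain_mnoSigma {k : MNO} (hk : k ∈ N.group l) (n : ℕ) :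
    Measurable[mnoSigma N F s l k] (F.gain l k n) :=
  (comap_measurable (F.gain l k n)).mono
    (Source.sigma_le_iSup (i := (.gain ⟨k, hk⟩ n : Source N s l)) rfl) le_rfl

lemma measurable_power_mnoSigma {k : MNO} (hk : k ∈ (N.group l).erase s) (n : ℕ) :
    Measurable[mnoSigma N F s l k] (F.power l k n) :=
  (comap_measurable (F.power l k n)).mono
    (Source.sigma_le_iSup (i := (.power ⟨k, hk⟩ n : Source N s l)) rfl) le_rfl

variable [MeasurableSpace Ω] {P : Measure Ω}

lemma IsModel.source_le (hF : IsModel P N F s l x) (i : Source N s l) :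
    Source.sigma F i ≤ ‹MeasurableSpace Ω› := by
  rcases i with k | ⟨k, n⟩ | ⟨k, n⟩
  · exact pointSigma_le (hF.bs_poisson k k.2).measurable
  · exact (hF.gain_measurable k k.2 n).comap_le
  · exact (hF.power_measurable k k.2 n).comap_le

lemma IsModel.mnoSigma_le (hF : IsModel P N F s l x) (k : MNO) :
    mnoSigma N F s l k ≤ ‹MeasurableSpace Ω› :=
  iSup₂_le fun i _ => hF.source_le i

lemma IsModel.gain_indep (hF : IsModel P N F s l x) {k : MNO} (hk : k ∈ N.group l) (n : ℕ) :
    Indep (MeasurableSpace.comap (F.gain l k n) inferInstance)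
      (markedSigma (F.bs k) (F.gain l k) n) P := by
  refine indep_of_le_iSup hF.source_le hF.indep (S := {.gain ⟨k, hk⟩ n}) (T := {.gain ⟨k, hk⟩ n}ᶜ)
    disjoint_compl_right (Source.sigma_le_iSup (i := .gain ⟨k, hk⟩ n) rfl)
    (markedSigma_le_of_le (Source.sigma_le_iSup (i := .bs ⟨k, hk⟩) ?_)
      fun j hj => Source.sigma_le_iSup (i := .gain ⟨k, hk⟩ j) ?_)
  · simp
  · simpa using hj.ne

lemma comap_buyerMark_le {MNO Band Ω : Type*} {F : Randomness MNO Band Ω} {l : Band} {b : MNO} {n : ℕ} {𝓐 : MeasurableSpace Ω}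
    (h1 : MeasurableSpace.comap (F.power l b n) inferInstance ≤ 𝓐)
    (h2 : MeasurableSpace.comap (F.gain l b n) inferInstance ≤ 𝓐) :
    MeasurableSpace.comap (buyerMark F l b n) inferInstance ≤ 𝓐 :=
  Measurable.comap_le (Measurable.prodMk (measurable_iff_comap_le.2 h1) (measurable_iff_comap_le.2 h2))

/-- Power and gain of one station form a single mark, so both sources are set apart from the rest
together. -/
lemma IsModel.buyerMark_indep (hF : IsModel P N F s l x) {b : MNO} (hb : b ∈ (N.group l).erase s)
    (n : ℕ) :
    Indep (MeasurableSpace.comap (buyerMark F l b n) inferInstance)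
      (markedSigma (F.bs b) (buyerMark F l b) n) P := by
  have hb' := Finset.mem_of_mem_erase hb
  let S : Set (Source N s l) := {.power ⟨b, hb⟩ n, .gain ⟨b, hb'⟩ n}
  refine indep_of_le_iSup hF.source_le hF.indep (S := S) (T := Sᶜ)
    disjoint_compl_right
    (comap_buyerMark_le (Source.sigma_le_iSup (i := .power ⟨b, hb⟩ n) (Or.inl rfl))
      (Source.sigma_le_iSup (i := .gain ⟨b, hb'⟩ n) (Or.inr rfl)))
    (markedSigma_le_of_le (Source.sigma_le_iSup (i := .bs ⟨b, hb'⟩) ?_)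
      fun j hj => comap_buyerMark_le (Source.sigma_le_iSup (i := .power ⟨b, hb⟩ j) ?_)
        (Source.sigma_le_iSup (i := .gain ⟨b, hb'⟩ j) ?_))
  · simp [S]
  · simpa [S] using hj.ne
  · simpa [S] using hj.ne

lemma IsModel.measurable_buyerMark (hF : IsModel P N F s l x) {b : MNO}
    (hb : b ∈ (N.group l).erase s) (n : ℕ) : Measurable (buyerMark F l b n) :=
  (hF.power_measurable b hb n).prodMk (hF.gain_measurable b (Finset.mem_of_mem_erase hb) n)

variable [IsProbabilityMeasure P]

lemma IsModel.map_buyerMark (hF : IsModel P N F s l x) {b : MNO}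
    (hb : b ∈ (N.group l).erase s) (n : ℕ) :
    P.map (buyerMark F l b n) = (P.map (buyerPower N F s l x)).prod (expMeasure 1) := by
  have hb' := Finset.mem_of_mem_erase hb
  have hI : IndepFun (F.power l b n) (F.gain l b n) P := by
    rw [IndepFun_iff_Indep]
    exact hF.indep.indep (i := .power ⟨b, hb⟩ n) (j := .gain ⟨b, hb'⟩ n) (by simp)
  have h := (indepFun_iff_map_prod_eq_prod_map_map (hF.power_measurable b hb n).aemeasurable
    (hF.gain_measurable b hb' n).aemeasurable).1 hI
  rw [(hF.power_law b hb n).map_eq, hF.gain_law b hb' n] at h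
  exact h

/-- Functionals of the randomness of different MNOs are independent. -/
lemma IsModel.lintegral_prod_mno (hF : IsModel P N F s l x) {G : MNO → Ω → ℝ≥0∞} (T : Finset MNO)
    (hG : ∀ k ∈ T, Measurable[mnoSigma N F s l k] (G k)) :
    ∫⁻ ω, ∏ k ∈ T, G k ω ∂P = ∏ k ∈ T, ∫⁻ ω, G k ω ∂P := by
  induction T using Finset.induction_on with
  | empty => simp
  | insert a T ha ih =>
    simp_rw [Finset.prod_insert ha]
    rw [← ih fun k hk => hG k (Finset.mem_insert_of_mem hk)]
    have hle : ∀ k ∈ T, mnoSigma N F s l k ≤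
        ⨆ i ∈ {i : Source N s l | i.mno ∈ T}, Source.sigma F i := fun k hk =>
      biSup_mono fun i (hi : i.mno = k) => by rw [mem_ofPred_eq, hi]; exact hk
    refine lintegral_mul_eq_lintegral_mul_lintegral_of_independent_measurableSpace
      (hF.mnoSigma_le a) (iSup₂_le fun i _ => hF.source_le i)
      (indep_iSup_of_disjoint hF.source_le hF.indep
        (S := {i | i.mno = a}) (T := {i | i.mno ∈ T}) ?_)
      (hG a (Finset.mem_insert_self _ _))
      (Finset.measurable_prod _ fun k hk =>
        (hG k (Finset.mem_insert_of_mem hk)).mono (hle k hk) le_rfl)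
    exact Set.disjoint_left.2 fun i (h1 : i.mno = a) (h2 : i.mno ∈ T) => ha (h1 ▸ h2)

lemma lintegral_one_sub_expNeg_expMeasure {a : ℝ} (ha : 0 ≤ a) :
    ∫⁻ h, (1 - expNeg (ENNReal.ofReal (a * h))) ∂(expMeasure 1) =
      1 - ENNReal.ofReal (1 / (1 + a)) := by
  rw [lintegral_sub (by fun_prop) (by rw [lintegral_expNeg_expMeasure ha]; simp)
    (ae_of_all _ fun h => expNeg_le_one _), lintegral_expNeg_expMeasure ha]
  simp

/-- The contribution of a BS of the seller to the exponent: infinite within distance `r` of the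
origin, and its interference multiplied by `θ` beyond distance `t`. -/
def sellerExponent (N : Network MNO Band) (θ r t : ℝ) (q : Plane × ℝ) : ℝ≥0∞ :=
  (if ‖q.1‖ < r then ∞ else 0) +
    ENNReal.ofReal θ * (if t ≤ ‖q.1‖ then
      ENNReal.ofReal (N.sellerPower * q.2 * ‖q.1‖ ^ (-N.α)) else 0)

/-- The contribution of a BS of a buyer to the exponent. -/
def buyerExponent (N : Network MNO Band) (θ : ℝ) (q : Plane × (ℝ × ℝ)) : ℝ≥0∞ :=
  ENNReal.ofReal θ * ENNReal.ofReal (q.2.1 * q.2.2 * ‖q.1‖ ^ (-N.α))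

lemma measurable_sellerExponent (N : Network MNO Band) (θ r t : ℝ) :
    Measurable (sellerExponent N θ r t) := by
  have h1 : Measurable fun q : Plane × ℝ => ‖q.1‖ := measurable_fst.norm
  refine Measurable.add (Measurable.ite (measurableSet_lt h1 measurable_const) measurable_const
    measurable_const) (Measurable.const_mul (Measurable.ite (measurableSet_le measurable_const h1)
      ?_ measurable_const) _)
  fun_prop

lemma measurable_buyerExponent (N : Network MNO Band) (θ : ℝ) :
    Measurable (buyerExponent N θ) := by
  unfold buyerExponent
  fun_prop

end

/-! ### Laplace transforms of the interference. -/

section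

variable {MNO Band Ω : Type*} [DecidableEq MNO] {N : Network MNO Band} {F : Randomness MNO Band Ω}
  {s : MNO} {l : Band} {x : Plane}

/-- The interference from the BSs of the seller at distance at least `t`. -/
def sellerFar (N : Network MNO Band) (F : Randomness MNO Band Ω) (s : MNO) (l : Band) (t : ℝ)
    (ω : Ω) : ℝ≥0∞ :=
  ∑' n, if t ≤ ‖F.bs s n ω‖ then
    ENNReal.ofReal (N.sellerPower * F.gain l s n ω * ‖F.bs s n ω‖ ^ (-N.α)) else 0

/-- The interference from the BSs of a buyer. -/
def buyerInterference (N : Network MNO Band) (F : Randomness MNO Band Ω) (l : Band) (b : MNO)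
    (ω : Ω) : ℝ≥0∞ :=
  ∑' n : ℕ, ENNReal.ofReal (F.power l b n ω * F.gain l b n ω * ‖F.bs b n ω‖ ^ (-N.α))

lemma measurable_tsum_marked {E : Type*} {m : MeasurableSpace Ω} [MeasurableSpace E]
    {X : ℕ → Ω → Plane} {M : ℕ → Ω → E} (hX : ∀ n, Measurable (X n)) (hM : ∀ n, Measurable (M n))
    {v : Plane × E → ℝ≥0∞} (hv : Measurable v) : Measurable fun ω => ∑' n, v (X n ω, M n ω) :=
  Measurable.tsum fun n => hv.comp ((hX n).prodMk (hM n))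

lemma measurable_buyerInterference {m : MeasurableSpace Ω} {b : MNO}
    (hX : ∀ n, Measurable (F.bs b n)) (hp : ∀ n, Measurable (F.power l b n))
    (hg : ∀ n, Measurable (F.gain l b n)) : Measurable (buyerInterference N F l b) :=
  measurable_tsum_marked (M := fun n ω => (F.power l b n ω, F.gain l b n ω)) hX
    (fun n => (hp n).prodMk (hg n))
    (v := fun q => ENNReal.ofReal (q.2.1 * q.2.2 * ‖q.1‖ ^ (-N.α))) (by fun_prop)

/-- Because `r ≤ t`, the two parts of the weight live on disjoint regions: the disc contributes its
area, the region beyond `t` the path-loss integral, and the annulus between them nothing. -/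
lemma lintegral_sellerExponent (N : Network MNO Band) {θ r t : ℝ} (hθ : 0 ≤ θ)
    (hr : 0 ≤ r) (hrt : r ≤ t) :
    ∫⁻ y, ∫⁻ h, (1 - expNeg (sellerExponent N θ r t (y, h))) ∂(expMeasure 1) =
      ENNReal.ofReal (Real.pi * r ^ 2 + Real.pi * (θ * N.sellerPower) ^ (2 / N.α) *
        ∫ v in Ioi (t ^ 2 / (θ * N.sellerPower) ^ (2 / N.α)), 1 / (1 + v ^ (N.α / 2))) := by
  have hp := N.sellerPower_pos
  have hα := N.two_lt_α
  have h1 : ∀ y : Plane, ∫⁻ h, (1 - expNeg (sellerExponent N θ r t (y, h))) ∂(expMeasure 1) =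
      (Metric.ball 0 r).indicator 1 y + (if t ≤ ‖y‖ then
        1 - ENNReal.ofReal (1 / (1 + (θ * N.sellerPower) * ‖y‖ ^ (-N.α))) else 0) := by
    intro y
    by_cases hy : ‖y‖ < r
    · have hyt : ¬ t ≤ ‖y‖ := not_le.2 (hy.trans_le hrt)
      simp [sellerExponent, hy, hyt]
    · have hyb : y ∉ Metric.ball (0 : Plane) r := by simpa using hy
      rw [indicator_of_notMem hyb, zero_add]
      by_cases hyt : t ≤ ‖y‖
      · rw [if_pos hyt, ← lintegral_one_sub_expNeg_expMeasure (by positivity)]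
        refine lintegral_congr fun h => ?_
        simp only [sellerExponent, if_neg hy, if_pos hyt, zero_add]
        rw [← ENNReal.ofReal_mul hθ]
        congr 3
        ring
      · simp [sellerExponent, hy, hyt]
  simp_rw [h1]
  rw [lintegral_add_left (measurable_one.indicator Metric.isOpen_ball.measurableSet),
    lintegral_indicator_one Metric.isOpen_ball.measurableSet,
    lintegral_pathLoss hα (by positivity) (hr.trans hrt), EuclideanSpace.volume_ball_fin_two,
    ← ENNReal.ofReal_pow hr, ← ENNReal.ofReal_mul (by positivity), ← ENNReal.ofReal_add (by positivity)]
  · rw [mul_comm (r ^ 2)]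
  · have : 0 ≤ ∫ v in Ioi (t ^ 2 / (θ * N.sellerPower) ^ (2 / N.α)), 1 / (1 + v ^ (N.α / 2)) :=
      setIntegral_nonneg measurableSet_Ioi fun v hv => by
        have hv0 : (0 : ℝ) ≤ v := le_trans (by positivity) (le_of_lt hv)
        have : 0 ≤ v ^ (N.α / 2) := Real.rpow_nonneg hv0 _
        positivity
    positivity

variable [MeasurableSpace Ω] {P : Measure Ω}

lemma powerMoment_nonneg (hF : IsModel P N F s l x) (hζ : 0 ≤ N.threshold s) :
    0 ≤ powerMoment P N F s l x := by
  refine integral_nonneg_of_ae ?_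
  filter_upwards [ae_buyerPower_nonneg hF hζ] with ω hω using Real.rpow_nonneg hω _

variable [IsProbabilityMeasure P]

lemma lintegral_expNeg_seller (hF : IsModel P N F s l x) (hs : s ∈ N.group l)
    (hlam : 0 ≤ N.bsIntensity s) {θ r t : ℝ} (hθ : 0 ≤ θ) (hr : 0 ≤ r) (hrt : r ≤ t) :
    ∫⁻ ω, expNeg (∑' n, sellerExponent N θ r t (F.bs s n ω, F.gain l s n ω)) ∂P =
      expNeg (ENNReal.ofReal (N.bsIntensity s *
        (Real.pi * r ^ 2 + Real.pi * (θ * N.sellerPower) ^ (2 / N.α) *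
          ∫ v in Ioi (t ^ 2 / (θ * N.sellerPower) ^ (2 / N.α)), 1 / (1 + v ^ (N.α / 2))))) := by
  rw [(hF.bs_poisson s hs).lintegral_expNeg_tsum_marked hlam (hF.gain_measurable s hs)
    (hF.gain_law s hs) (hF.gain_indep hs) (measurable_sellerExponent N θ r t),
    lintegral_sellerExponent N hθ hr hrt, ENNReal.ofReal_mul hlam]

/-- By Tonelli the positions are integrated first. At fixed power `p` the result is proportional to
`(θ p) ^ (2 / α)`, so the law of the power enters only through its finite moment of order `2 / α`.
-/
lemma lintegral_buyerExponent (hF : IsModel P N F s l x) (hμ : 0 < N.ueIntensity s)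
    (hζ : 0 < N.threshold s) {θ : ℝ} (hθ : 0 ≤ θ) :
    ∫⁻ y, ∫⁻ m, (1 - expNeg (buyerExponent N θ (y, m)))
        ∂((P.map (buyerPower N F s l x)).prod (expMeasure 1)) =
      ENNReal.ofReal (Real.pi * θ ^ (2 / N.α) * powerMoment P N F s l x * rhoInfty N.α) := by
  have hα := N.two_lt_α
  have hbm := measurable_buyerPower hF
  have : IsProbabilityMeasure (P.map (buyerPower N F s l x)) :=
    Measure.isProbabilityMeasure_map hbm.aemeasurable
  have hm : Measurable fun z : Plane × (ℝ × ℝ) => 1 - expNeg (buyerExponent N θ z) :=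
    measurable_const.sub (measurable_expNeg.comp (measurable_buyerExponent N θ))
  have hm' : Measurable fun z : (Plane × ℝ) × ℝ => 1 - expNeg (buyerExponent N θ (z.1.1, (z.1.2, z.2))) :=
    hm.comp (by fun_prop)
  have h1 : ∀ y : Plane, ∫⁻ m, (1 - expNeg (buyerExponent N θ (y, m)))
        ∂((P.map (buyerPower N F s l x)).prod (expMeasure 1)) =
      ∫⁻ p, ∫⁻ h, (1 - expNeg (buyerExponent N θ (y, (p, h)))) ∂(expMeasure 1)
        ∂(P.map (buyerPower N F s l x)) := fun y =>
    lintegral_prod _ (hm.comp measurable_prodMk_left).aemeasurable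
  simp_rw [h1]
  rw [lintegral_lintegral_swap (hm'.lintegral_prod_right').aemeasurable]
  have hp0 : ∀ᵐ p ∂(P.map (buyerPower N F s l x)), 0 ≤ p :=
    (ae_map_iff hbm.aemeasurable measurableSet_Ici).2 (ae_buyerPower_nonneg hF hζ.le)
  have h2 : ∀ᵐ p ∂(P.map (buyerPower N F s l x)),
      ∫⁻ y : Plane, ∫⁻ h, (1 - expNeg (buyerExponent N θ (y, (p, h)))) ∂(expMeasure 1) =
        ENNReal.ofReal (Real.pi * θ ^ (2 / N.α) * rhoInfty N.α) * ENNReal.ofReal (p ^ (2 / N.α)) := by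
    filter_upwards [hp0] with p hp
    have h3 : ∀ y : Plane, ∫⁻ h, (1 - expNeg (buyerExponent N θ (y, (p, h)))) ∂(expMeasure 1) =
        if 0 ≤ ‖y‖ then 1 - ENNReal.ofReal (1 / (1 + (θ * p) * ‖y‖ ^ (-N.α))) else 0 := by
      intro y
      rw [if_pos (norm_nonneg y), ← lintegral_one_sub_expNeg_expMeasure (by positivity)]
      refine lintegral_congr fun h => ?_
      simp only [buyerExponent]
      rw [← ENNReal.ofReal_mul hθ]
      congr 3
      ring
    simp_rw [h3]
    have hρ := rhoInfty_nonneg N.α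
    rw [lintegral_pathLoss hα (by positivity) le_rfl, ← ENNReal.ofReal_mul (by positivity),
      Real.mul_rpow hθ hp]
    congr 1
    rw [zero_pow two_ne_zero, zero_div, ← rhoInfty]
    ring
  rw [lintegral_congr_ae h2, lintegral_const_mul _ (by fun_prop), lintegral_map (by fun_prop) hbm,
    ← ofReal_integral_eq_lintegral_ofReal (integrable_buyerPower_rpow hF hμ hζ), ← powerMoment,
    ← ENNReal.ofReal_mul]
  · congr 1; ring
  · have hρ := rhoInfty_nonneg N.α
    positivity
  · filter_upwards [ae_buyerPower_nonneg hF hζ.le] with ω hω using Real.rpow_nonneg hω _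

lemma lintegral_expNeg_buyer (hF : IsModel P N F s l x) (hμ : 0 < N.ueIntensity s)
    (hζ : 0 < N.threshold s) {b : MNO} (hb : b ∈ (N.group l).erase s)
    (hlam : 0 ≤ N.bsIntensity b) {θ : ℝ} (hθ : 0 ≤ θ) :
    ∫⁻ ω, expNeg (ENNReal.ofReal θ * buyerInterference N F l b ω) ∂P =
      expNeg (ENNReal.ofReal (N.bsIntensity b *
        (Real.pi * θ ^ (2 / N.α) * powerMoment P N F s l x * rhoInfty N.α))) := by
  have h := (hF.bs_poisson b (Finset.mem_of_mem_erase hb)).lintegral_expNeg_tsum_marked hlam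
    (hF.measurable_buyerMark hb) (hF.map_buyerMark hb) (hF.buyerMark_indep hb)
    (measurable_buyerExponent N θ)
  rw [lintegral_buyerExponent hF hμ hζ hθ, ← ENNReal.ofReal_mul hlam] at h
  rw [← h]
  refine lintegral_congr fun ω => ?_
  rw [buyerInterference, ← ENNReal.tsum_mul_left]
  rfl

/-- The joint Laplace transform of the interference, on the event that the seller has no BS within
distance `r`. -/
lemma lintegral_void_mul_expNeg (hF : IsModel P N F s l x) (hs : s ∈ N.group l)
    (hlam : ∀ k ∈ N.group l, 0 ≤ N.bsIntensity k) (hμ : 0 < N.ueIntensity s)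
    (hζ : 0 < N.threshold s) {θ r t : ℝ} (hθ : 0 ≤ θ) (hr : 0 ≤ r) (hrt : r ≤ t) :
    ∫⁻ ω, {ω | ∀ n, F.bs s n ω ∉ Metric.ball 0 r}.indicator (fun ω => expNeg (ENNReal.ofReal θ *
        (sellerFar N F s l t ω + ∑ b ∈ (N.group l).erase s, buyerInterference N F l b ω))) ω ∂P =
      ENNReal.ofReal (Real.exp (-(Real.pi * N.bsIntensity s * r ^ 2)) *
        (Real.exp (-(N.bsIntensity s * (Real.pi * (θ * N.sellerPower) ^ (2 / N.α) *
          ∫ v in Ioi (t ^ 2 / (θ * N.sellerPower) ^ (2 / N.α)), 1 / (1 + v ^ (N.α / 2))))) *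
        Real.exp (-(Real.pi * buyerIntensity N s l * powerMoment P N F s l x * θ ^ (2 / N.α) *
          rhoInfty N.α)))) := by
  classical
  have hp := N.sellerPower_pos
  -- One factor per operator; that of the seller carries the void event as well as the far
  -- interference, so independence of the operators gives the whole product.
  let G : MNO → Ω → ℝ≥0∞ := fun k ω =>
    if k = s then expNeg (∑' n, sellerExponent N θ r t (F.bs s n ω, F.gain l s n ω))
    else expNeg (ENNReal.ofReal θ * buyerInterference N F l k ω)
  have hGs : G s = fun ω => expNeg (∑' n, sellerExponent N θ r t (F.bs s n ω, F.gain l s n ω)) := by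
    funext ω; simp [G]
  have hGb : ∀ b ∈ (N.group l).erase s,
      G b = fun ω => expNeg (ENNReal.ofReal θ * buyerInterference N F l b ω) := fun b hb => by
    funext ω; simp [G, (Finset.mem_erase.1 hb).1]
  have hint : ∀ ω, {ω | ∀ n, F.bs s n ω ∉ Metric.ball 0 r}.indicator (fun ω =>
      expNeg (ENNReal.ofReal θ * (sellerFar N F s l t ω +
        ∑ b ∈ (N.group l).erase s, buyerInterference N F l b ω))) ω = ∏ k ∈ N.group l, G k ω := by
    intro ω
    have e1 : G s ω = {ω | ∀ n, F.bs s n ω ∉ Metric.ball 0 r}.indicator 1 ω *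
        expNeg (ENNReal.ofReal θ * sellerFar N F s l t ω) := by
      have := ite_forall_notMem_eq_expNeg (Metric.ball (0 : Plane) r) (fun n => F.bs s n ω)
      rw [hGs]
      simp only [sellerExponent, ENNReal.tsum_add, expNeg_add, ENNReal.tsum_mul_left, sellerFar]
      congr 1
      simp only [mem_ball_zero_iff] at this ⊢
      rw [← this]
      simp [indicator]
    rw [← Finset.mul_prod_erase _ _ hs, e1, Finset.prod_congr rfl fun b hb => congrFun (hGb b hb) ω,
      ← expNeg_sum, mul_assoc, ← expNeg_add, ← Finset.mul_sum, ← mul_add]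
    simp [indicator]
  simp_rw [hint]
  rw [hF.lintegral_prod_mno, ← Finset.mul_prod_erase _ _ hs, hGs,
    lintegral_expNeg_seller hF hs (hlam s hs) hθ hr hrt,
    Finset.prod_congr rfl fun b hb => by
      rw [hGb b hb, lintegral_expNeg_buyer hF hμ hζ hb (hlam b (Finset.mem_of_mem_erase hb)) hθ],
    ← expNeg_sum]
  · have hM := powerMoment_nonneg hF hζ.le
    have hρ := rhoInfty_nonneg N.α
    have hJ : 0 ≤ ∫ v in Ioi (t ^ 2 / (θ * N.sellerPower) ^ (2 / N.α)), 1 / (1 + v ^ (N.α / 2)) :=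
      setIntegral_nonneg measurableSet_Ioi fun v hv => by
        have hv0 : (0 : ℝ) ≤ v := le_trans (by positivity) (le_of_lt hv)
        have : 0 ≤ v ^ (N.α / 2) := Real.rpow_nonneg hv0 _
        positivity
    have hls := hlam s hs
    have hb0 : ∀ b ∈ (N.group l).erase s, 0 ≤ N.bsIntensity b *
        (Real.pi * θ ^ (2 / N.α) * powerMoment P N F s l x * rhoInfty N.α) := fun b hb => by
      have := hlam b (Finset.mem_of_mem_erase hb)
      positivity
    rw [← ENNReal.ofReal_sum_of_nonneg hb0, expNeg_ofReal (by positivity),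
      expNeg_ofReal (Finset.sum_nonneg hb0), ← ENNReal.ofReal_mul (by positivity),
      ← Finset.sum_mul, ← buyerIntensity, ← Real.exp_add, ← Real.exp_add, ← Real.exp_add]
    congr 2
    ring
  · intro k hk
    by_cases hks : k = s
    · subst hks
      rw [hGs]
      exact measurable_expNeg.comp (measurable_tsum_marked (measurable_bs_mnoSigma hk)
        (measurable_gain_mnoSigma hk) (measurable_sellerExponent N θ r t))
    · have hb : k ∈ (N.group l).erase s := Finset.mem_erase.2 ⟨hks, hk⟩
      rw [hGb k hb]
      exact measurable_expNeg.comp (measurable_const.mul (measurable_buyerInterference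
        (measurable_bs_mnoSigma hk) (measurable_power_mnoSigma hb) (measurable_gain_mnoSigma hk)))

end

/-! ### The serving station and finiteness of the interference. -/

section

variable {MNO Band Ω : Type*} [DecidableEq MNO] {N : Network MNO Band} {F : Randomness MNO Band Ω}
  {s : MNO} {l : Band} {x : Plane}

lemma measurable_sInf_nat {m : MeasurableSpace Ω} {S : Ω → Set ℕ}
    (hS : ∀ n, MeasurableSet {ω | n ∈ S ω}) : Measurable fun ω => sInf (S ω) := by
  classical
  refine measurable_to_countable' fun n => ?_
  have : (fun ω => sInf (S ω)) ⁻¹' {n} =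
      ({ω | n ∈ S ω} ∩ ⋂ k ∈ Finset.range n, {ω | k ∈ S ω}ᶜ) ∪
        -- The infimum of the empty set of naturals is `0`.
        (if n = 0 then ⋂ k, {ω | k ∈ S ω}ᶜ else ∅) := by
    ext ω
    simp only [mem_preimage, mem_singleton_iff, mem_union, mem_inter_iff, mem_iInter,
      Finset.mem_range, mem_compl_iff, mem_ofPred_eq]
    constructor
    · rintro rfl
      rcases (S ω).eq_empty_or_nonempty with h | h
      · right; simp [h]
      · exact Or.inl ⟨Nat.sInf_mem h, fun k hk => Nat.notMem_of_lt_sInf hk⟩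
    · rintro (⟨h1, h2⟩ | h)
      · refine le_antisymm (Nat.sInf_le h1) (not_lt.1 fun hlt => ?_)
        exact h2 _ hlt (Nat.sInf_mem ⟨n, h1⟩)
      · split_ifs at h with hn
        · simp only [mem_iInter, mem_compl_iff, mem_ofPred_eq] at h
          have : S ω = ∅ := eq_empty_of_forall_notMem h
          simp [this, hn]
        · exact absurd h (notMem_empty _)
  rw [this]
  refine ((hS n).inter (Finset.measurableSet_biInter _ fun k _ => (hS k).compl)).union ?_
  split_ifs
  · exact MeasurableSet.iInter fun k => (hS k).compl
  · exact MeasurableSet.empty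

lemma measurable_comp_nat {E : Type*} {m : MeasurableSpace Ω} [MeasurableSpace E] {J : Ω → ℕ}
    {g : ℕ → Ω → E} (hJ : Measurable J) (hg : ∀ j, Measurable (g j)) :
    Measurable fun ω => g (J ω) ω := by
  have h : Measurable fun q : ℕ × Ω => g q.1 q.2 := measurable_from_prod_countable_right hg
  exact h.comp (hJ.prodMk measurable_id)

lemma measurable_servingBS {m : MeasurableSpace Ω} (hX : ∀ n, Measurable (F.bs s n)) :
    Measurable (servingBS N F s) := by
  refine measurable_sInf_nat (S := fun ω => {n | ∀ m, meanRxPower N F s m ω ≤ meanRxPower N F s n ω})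
    fun n => ?_
  have hrx : ∀ n, Measurable (meanRxPower N F s n) := fun n =>
    measurable_const.mul ((measurable_norm.comp (hX n)).pow_const _)
  have : {ω | n ∈ {n | ∀ m, meanRxPower N F s m ω ≤ meanRxPower N F s n ω}} =
      ⋂ m, {ω | meanRxPower N F s m ω ≤ meanRxPower N F s n ω} := by ext; simp
  rw [this]
  exact MeasurableSet.iInter fun m => measurableSet_le (hrx m) (hrx n)

lemma measurable_servingDist {m : MeasurableSpace Ω} (hX : ∀ n, Measurable (F.bs s n)) :
    Measurable (servingDist N F s) :=
  measurable_norm.comp (measurable_comp_nat (measurable_servingBS hX) hX)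

lemma servingDist_nonneg (ω : Ω) : 0 ≤ servingDist N F s ω := norm_nonneg _

/-- A configuration in general position: locally finite, no point at the origin, and no two points
at the same distance. -/
structure InGeneralPosition (z : ℕ → Plane) : Prop where
  ne_zero : ∀ n, z n ≠ 0
  finite : ∀ R : ℝ, {n | ‖z n‖ < R}.Finite
  inj : ∀ i j, ‖z i‖ = ‖z j‖ → i = j

/-- In general position, the serving BS is the unique nearest one. -/
lemma InGeneralPosition.servingDist_lt {ω : Ω} (h : InGeneralPosition fun n => F.bs s n ω) {m : ℕ}
    (hm : m ≠ servingBS N F s ω) : servingDist N F s ω < ‖F.bs s m ω‖ := by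
  have hα := N.two_lt_α
  have hle : ∀ m n, meanRxPower N F s m ω ≤ meanRxPower N F s n ω ↔
      ‖F.bs s n ω‖ ≤ ‖F.bs s m ω‖ := fun m n => by
    rw [meanRxPower, meanRxPower, mul_le_mul_iff_right₀ N.sellerPower_pos,
      Real.rpow_le_rpow_iff_of_neg (norm_pos_iff.2 (h.ne_zero m)) (norm_pos_iff.2 (h.ne_zero n))
        (by linarith)]
  -- The minimal distance is attained: finitely many stations, number `0` among them, lie within
  -- `‖F.bs s 0 ω‖ + 1`, and all others are farther.
  have hne : {n | ∀ m, meanRxPower N F s m ω ≤ meanRxPower N F s n ω}.Nonempty := by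
    obtain ⟨n, hn, hmin⟩ := Set.exists_min_image _ (fun n => ‖F.bs s n ω‖)
      (h.finite (‖F.bs s 0 ω‖ + 1)) ⟨0, by simp⟩
    refine ⟨n, fun m => (hle m n).2 ?_⟩
    by_cases hm : ‖F.bs s m ω‖ < ‖F.bs s 0 ω‖ + 1
    · exact hmin m hm
    · exact (le_of_lt hn).trans (not_lt.1 hm)
  have hmem := Nat.sInf_mem hne
  exact lt_of_le_of_ne ((hle m _).1 (hmem m)) fun he => hm (h.inj _ _ he).symm

/-- Events about the serving distance become void events, which is how the Laplace functional
reaches it. -/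
lemma InGeneralPosition.forall_le_iff {ω : Ω} (h : InGeneralPosition fun n => F.bs s n ω) (r : ℝ) :
    (∀ n, F.bs s n ω ∉ Metric.ball 0 r) ↔ r ≤ servingDist N F s ω := by
  simp only [mem_ball_zero_iff, not_lt]
  refine ⟨fun hr => hr _, fun hr n => ?_⟩
  by_cases hn : n = servingBS N F s ω
  · rw [hn]; exact hr
  · exact hr.trans (h.servingDist_lt hn).le

lemma InGeneralPosition.forall_lt_iff {ω : Ω} (h : InGeneralPosition fun n => F.bs s n ω) (r : ℝ) :
    (∀ n, F.bs s n ω ∉ Metric.closedBall 0 r) ↔ r < servingDist N F s ω := by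
  simp only [mem_closedBall_zero_iff, not_le]
  refine ⟨fun hr => hr _, fun hr n => ?_⟩
  by_cases hn : n = servingBS N F s ω
  · rw [hn]; exact hr
  · exact hr.trans (h.servingDist_lt hn)

/-- The interference when the BS of the seller with number `j` is the serving one. -/
def interferenceExcept (N : Network MNO Band) (F : Randomness MNO Band Ω) (s : MNO) (l : Band)
    (j : ℕ) (ω : Ω) : ℝ≥0∞ :=
  (∑' n, if n ≠ j then
    ENNReal.ofReal (N.sellerPower * F.gain l s n ω * ‖F.bs s n ω‖ ^ (-N.α)) else 0) +
    ∑ b ∈ (N.group l).erase s, buyerInterference N F l b ω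

lemma interference_eq (ω : Ω) :
    interference N F s l ω = interferenceExcept N F s l (servingBS N F s ω) ω := by
  classical
  rw [interference, interferenceExcept]
  congr 1
  refine (tsum_subtype {n | n ≠ servingBS N F s ω} fun n =>
    ENNReal.ofReal (N.sellerPower * F.gain l s n ω * ‖F.bs s n ω‖ ^ (-N.α))).trans
    (tsum_congr fun n => ?_)
  simp [indicator]

lemma interferenceExcept_le (j : ℕ) (ω : Ω) : interferenceExcept N F s l j ω ≤
    sellerFar N F s l 0 ω + ∑ b ∈ (N.group l).erase s, buyerInterference N F l b ω := by
  refine add_le_add_left (ENNReal.tsum_le_tsum fun n => ?_) _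
  rw [if_pos (norm_nonneg _)]
  split_ifs
  · exact le_rfl
  · exact zero_le

lemma measurable_interferenceExcept {m : MeasurableSpace Ω} {j : ℕ}
    (hX : ∀ n, Measurable (F.bs s n)) (hg : ∀ n ≠ j, Measurable (F.gain l s n))
    (hB : ∀ b ∈ (N.group l).erase s, Measurable (buyerInterference N F l b)) :
    Measurable (interferenceExcept N F s l j) := by
  refine Measurable.add (Measurable.tsum fun n => ?_) (Finset.measurable_sum _ hB)
  by_cases hn : n = j
  · simp [hn]
  · simp only [ne_eq, hn, not_false_eq_true, if_true]
    exact ENNReal.measurable_ofReal.comp ((measurable_const.mul (hg n hn)).mul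
      ((measurable_norm.comp (hX n)).pow_const _))

lemma measurable_sellerFar {m : MeasurableSpace Ω} (hX : ∀ n, Measurable (F.bs s n))
    (hg : ∀ n, Measurable (F.gain l s n)) (t : ℝ) : Measurable (sellerFar N F s l t) := by
  refine measurable_tsum_marked (M := fun n => F.gain l s n) hX hg (v := fun q => if t ≤ ‖q.1‖ then
    ENNReal.ofReal (N.sellerPower * q.2 * ‖q.1‖ ^ (-N.α)) else 0) ?_
  exact Measurable.ite (measurableSet_le measurable_const measurable_fst.norm) (by fun_prop)
    measurable_const

variable [MeasurableSpace Ω] {P : Measure Ω}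

lemma IsModel.measurable_buyerSum (hF : IsModel P N F s l x) :
    Measurable fun ω => ∑ b ∈ (N.group l).erase s, buyerInterference N F l b ω :=
  Finset.measurable_sum _ fun b hb =>
    have hb' := Finset.mem_of_mem_erase hb
    measurable_buyerInterference (hF.bs_poisson b hb').measurable (hF.power_measurable b hb)
      (hF.gain_measurable b hb')

lemma IsModel.measurable_interference (hF : IsModel P N F s l x) (hs : s ∈ N.group l) :
    Measurable (interference N F s l) := by
  have : interference N F s l = fun ω => interferenceExcept N F s l (servingBS N F s ω) ω :=
    funext interference_eq
  rw [this]
  refine measurable_comp_nat (measurable_servingBS (hF.bs_poisson s hs).measurable) fun j =>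
    measurable_interferenceExcept (hF.bs_poisson s hs).measurable
      (fun n _ => hF.gain_measurable s hs n) fun b hb => ?_
  have hb' := Finset.mem_of_mem_erase hb
  exact measurable_buyerInterference (hF.bs_poisson b hb').measurable (hF.power_measurable b hb)
    (hF.gain_measurable b hb')

variable [IsProbabilityMeasure P]

lemma IsPoissonProcess.ae_inGeneralPosition {X : ℕ → Ω → Plane} {lam : ℝ}
    (hX : IsPoissonProcess P X lam) (hlam : 0 ≤ lam) :
    ∀ᵐ ω ∂P, InGeneralPosition fun n => X n ω := by
  filter_upwards [hX.ae_notMem hlam (measurableSet_singleton 0) (by simp), hX.ae_finite,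
    hX.ae_norm_injective hlam] with ω h1 h2 h3
  exact ⟨h1, h2, h3⟩

/-- The interference is almost surely finite. -/
theorem IsModel.ae_interference_lt_top (hF : IsModel P N F s l x) (hs : s ∈ N.group l)
    (hlam : ∀ k ∈ N.group l, 0 ≤ N.bsIntensity k) (hμ : 0 < N.ueIntensity s)
    (hζ : 0 < N.threshold s) : ∀ᵐ ω ∂P, interference N F s l ω < ∞ := by
  have hα := N.two_lt_α
  -- Adding back the signal of the serving station gives a larger sum, free of the random index,
  -- whose transform is known.
  let S : Ω → ℝ≥0∞ := fun ω =>
    sellerFar N F s l 0 ω + ∑ b ∈ (N.group l).erase s, buyerInterference N F l b ω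
  have hSm : Measurable S := (measurable_sellerFar (hF.bs_poisson s hs).measurable
    (hF.gain_measurable s hs) 0).add hF.measurable_buyerSum
  have hSf : MeasurableSet {ω | S ω < ∞} := measurableSet_lt hSm measurable_const
  let g : ℝ → ℝ := fun θ => Real.exp (-(Real.pi * N.bsIntensity s * 0)) *
        (Real.exp (-(N.bsIntensity s * (Real.pi * (θ * N.sellerPower) ^ (2 / N.α) *
          rhoInfty N.α))) *
        Real.exp (-(Real.pi * buyerIntensity N s l * powerMoment P N F s l x * θ ^ (2 / N.α) *
          rhoInfty N.α)))
  have hg : Continuous g := by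
    have h2 : 0 ≤ 2 / N.α := by positivity
    have e1 : Continuous fun θ : ℝ => (θ * N.sellerPower) ^ (2 / N.α) :=
      (continuous_id.mul continuous_const).rpow_const fun _ => Or.inr h2
    have e2 : Continuous fun θ : ℝ => θ ^ (2 / N.α) := continuous_id.rpow_const fun _ => Or.inr h2
    fun_prop
  -- For `θ > 0`, `exp (-θ S)` vanishes where `S = ∞`, so its mean `g θ` bounds the probability of
  -- finiteness from below; `g θ` tends to `1` as `θ` tends to `0`.
  have hle : ∀ k : ℕ, ENNReal.ofReal (g (1 / ((k : ℝ) + 1))) ≤ P {ω | S ω < ∞} := by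
    intro k
    have hθ : (0 : ℝ) ≤ 1 / ((k : ℝ) + 1) := by positivity
    have h := lintegral_void_mul_expNeg hF hs hlam hμ hζ hθ le_rfl (le_refl 0)
    rw [zero_pow two_ne_zero, zero_div, ← rhoInfty] at h
    rw [← h, ← lintegral_indicator_one hSf]
    refine lintegral_mono fun ω => ?_
    refine (indicator_le_self _ _ _).trans ?_
    by_cases hω : S ω < ∞
    · rw [indicator_of_mem (by exact hω)]
      exact expNeg_le_one _
    · rw [indicator_of_notMem (by exact hω)]
      have hω' : sellerFar N F s l 0 ω + ∑ b ∈ (N.group l).erase s, buyerInterference N F l b ω = ∞ :=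
        not_lt_top_iff.1 hω
      rw [hω', ENNReal.mul_top (by simp; positivity), expNeg_top]
  have hlim : Tendsto (fun k : ℕ => ENNReal.ofReal (g (1 / ((k : ℝ) + 1)))) atTop (𝓝 1) := by
    have h0 : g 0 = 1 := by
      have h2 : (0 : ℝ) ^ (2 / N.α) = 0 := Real.zero_rpow (by positivity)
      simp [g, h2]
    have h := ENNReal.tendsto_ofReal
      ((hg.tendsto 0).comp (tendsto_one_div_add_atTop_nhds_zero_nat (𝕜 := ℝ)))
    rwa [h0, ENNReal.ofReal_one] at h
  have h1 : P {ω | S ω < ∞} = 1 := le_antisymm prob_le_one (le_of_tendsto' hlim hle)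
  have hae : ∀ᵐ ω ∂P, S ω < ∞ := (mem_ae_iff_prob_eq_one hSf).2 h1
  filter_upwards [hae] with ω hω
  rw [interference_eq]
  exact (interferenceExcept_le _ ω).trans_lt hω

end

/-! ### Discretising the serving distance. -/

section

lemma lintegral_comp_nat {Ω : Type*} [MeasurableSpace Ω] {P : Measure Ω} {J : Ω → ℕ}
    (hJ : Measurable J) {g : ℕ → Ω → ℝ≥0∞} (hg : ∀ j, Measurable (g j)) :
    ∫⁻ ω, g (J ω) ω ∂P = ∑' j, ∫⁻ ω, {ω | J ω = j}.indicator (g j) ω ∂P := by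
  have hS : ∀ j, MeasurableSet {ω | J ω = j} := fun j => hJ (measurableSet_singleton j)
  rw [← lintegral_tsum fun j => ((hg j).indicator (hS j)).aemeasurable]
  refine lintegral_congr fun ω => ?_
  rw [tsum_eq_single (J ω)]
  · simp
  · intro j hj
    exact indicator_of_notMem (s := {ω | J ω = j}) (fun h : J ω = j => hj h.symm) _

variable {MNO Band Ω : Type*} [DecidableEq MNO] {N : Network MNO Band} {F : Randomness MNO Band Ω}
  {s : MNO} {l : Band} {x : Plane} [MeasurableSpace Ω] {P : Measure Ω}

lemma IsModel.measure_le_servingDist [IsProbabilityMeasure P] (hF : IsModel P N F s l x) (hs : s ∈ N.group l)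
    (hlam : 0 ≤ N.bsIntensity s) {r : ℝ} (hr : 0 ≤ r) :
    P {ω | r ≤ servingDist N F s ω} =
      ENNReal.ofReal (Real.exp (-(Real.pi * N.bsIntensity s * r ^ 2))) := by
  have hX := hF.bs_poisson s hs
  have h := hX.void_probability hlam (A := Metric.ball 0 r) Metric.isOpen_ball.measurableSet
  rw [EuclideanSpace.volume_ball_fin_two, ← ENNReal.ofReal_pow hr,
    ← ENNReal.ofReal_mul (by positivity), ← ENNReal.ofReal_mul hlam,
    expNeg_ofReal (by positivity)] at h
  rw [show Real.pi * N.bsIntensity s * r ^ 2 = N.bsIntensity s * (r ^ 2 * Real.pi) by ring, ← h]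
  refine measure_congr ?_
  filter_upwards [hX.ae_inGeneralPosition hlam] with ω hω
  exact propext (hω.forall_le_iff r).symm

lemma IsModel.measure_lt_servingDist [IsProbabilityMeasure P] (hF : IsModel P N F s l x) (hs : s ∈ N.group l)
    (hlam : 0 ≤ N.bsIntensity s) {r : ℝ} (hr : 0 ≤ r) :
    P {ω | r < servingDist N F s ω} =
      ENNReal.ofReal (Real.exp (-(Real.pi * N.bsIntensity s * r ^ 2))) := by
  have hX := hF.bs_poisson s hs
  have h := hX.void_probability hlam (A := Metric.closedBall 0 r)
    Metric.isClosed_closedBall.measurableSet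
  rw [EuclideanSpace.volume_closedBall_fin_two, ← ENNReal.ofReal_pow hr,
    ← ENNReal.ofReal_mul (by positivity), ← ENNReal.ofReal_mul hlam,
    expNeg_ofReal (by positivity)] at h
  rw [show Real.pi * N.bsIntensity s * r ^ 2 = N.bsIntensity s * (r ^ 2 * Real.pi) by ring, ← h]
  refine measure_congr ?_
  filter_upwards [hX.ae_inGeneralPosition hlam] with ω hω
  exact propext (hω.forall_lt_iff r).symm

/-- The exponential of the interference from beyond distance `t`, at `β t ^ α / Pˢ`. -/
def farFactor (N : Network MNO Band) (F : Randomness MNO Band Ω) (s : MNO) (l : Band) (β t : ℝ)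
    (ω : Ω) : ℝ≥0∞ :=
  expNeg (ENNReal.ofReal (β * t ^ N.α / N.sellerPower) *
    (sellerFar N F s l t ω + ∑ b ∈ (N.group l).erase s, buyerInterference N F l b ω))

lemma IsModel.measurable_farFactor (hF : IsModel P N F s l x) (hs : s ∈ N.group l) (β t : ℝ) :
    Measurable (farFactor N F s l β t) :=
  measurable_expNeg.comp (measurable_const.mul ((measurable_sellerFar
    (hF.bs_poisson s hs).measurable (hF.gain_measurable s hs) t).add hF.measurable_buyerSum))

/-- The hypotheses on the intensities and the threshold that the theorems need. -/
structure PositiveParameters (N : Network MNO Band) (s : MNO) (l : Band) : Prop where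
  mem : s ∈ N.group l
  bs : ∀ k ∈ N.group l, 0 < N.bsIntensity k
  ue : 0 < N.ueIntensity s
  threshold : 0 < N.threshold s

/-- At `κ = β t ^ α / Pˢ` the lower limit `t ^ 2 / (κ Pˢ) ^ (2 / α)` equals `β ^ (-2 / α)` for every
`t`, which is where `rho` comes from. The remaining factor is the void probability. -/
lemma IsModel.lintegral_indicator_farFactor [IsProbabilityMeasure P] (hF : IsModel P N F s l x)
    (hN : PositiveParameters N s l) {β r t : ℝ} (hβ : 0 < β) (hr : 0 ≤ r) (hrt : r ≤ t)
    (ht : 0 < t) :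
    ∫⁻ ω, {ω | r ≤ servingDist N F s ω}.indicator (farFactor N F s l β t) ω ∂P =
      P {ω | r ≤ servingDist N F s ω} *
        ENNReal.ofReal (laplaceFormula P N F s l x β (β * t ^ N.α / N.sellerPower)) := by
  have hα := N.two_lt_α
  have hp := N.sellerPower_pos
  set θ := β * t ^ N.α / N.sellerPower with hθ
  have hθ0 : 0 ≤ θ := by positivity
  have h := lintegral_void_mul_expNeg hF hN.mem (fun k hk => (hN.bs k hk).le) hN.ue hN.threshold
    hθ0 hr hrt
  have e1 : (θ * N.sellerPower) ^ (2 / N.α) = β ^ (2 / N.α) * t ^ 2 := by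
    rw [hθ, div_mul_cancel₀ _ hp.ne', Real.mul_rpow hβ.le (by positivity), ← Real.rpow_mul ht.le,
      mul_div_cancel₀ _ (by positivity : N.α ≠ 0)]
    norm_num
  have e2 : t ^ 2 / (θ * N.sellerPower) ^ (2 / N.α) = β ^ (-2 / N.α) := by
    rw [e1, neg_div, Real.rpow_neg hβ.le]
    field_simp
  rw [e2, ← rho, Real.mul_rpow hθ0 hp.le] at h
  rw [hF.measure_le_servingDist hN.mem (hN.bs s hN.mem).le hr, ← ENNReal.ofReal_mul (by positivity),
    laplaceFormula]
  refine Eq.trans (lintegral_congr_ae ?_) (h.trans ?_)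
  · filter_upwards [(hF.bs_poisson s hN.mem).ae_inGeneralPosition (hN.bs s hN.mem).le] with ω hω
    by_cases hr' : r ≤ servingDist N F s ω
    · rw [indicator_of_mem (by exact hr'), indicator_of_mem (by exact (hω.forall_le_iff r).2 hr')]
      rfl
    · rw [indicator_of_notMem (by exact hr'),
        indicator_of_notMem (by exact fun h => hr' ((hω.forall_le_iff r).1 h))]
  · congr 5
    ring

/-- The identity on `r ≤ D` minus the one on `t ≤ D`: the variable and the constant depend on `t`
alone, so only the event changes. -/
lemma IsModel.lintegral_cell_farFactor [IsProbabilityMeasure P] (hF : IsModel P N F s l x)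
    (hN : PositiveParameters N s l) {β r t : ℝ} (hβ : 0 < β) (hr : 0 ≤ r) (hrt : r ≤ t)
    (ht : 0 < t) :
    ∫⁻ ω, {ω | r ≤ servingDist N F s ω ∧ servingDist N F s ω < t}.indicator
        (farFactor N F s l β t) ω ∂P =
      P {ω | r ≤ servingDist N F s ω ∧ servingDist N F s ω < t} *
        ENNReal.ofReal (laplaceFormula P N F s l x β (β * t ^ N.α / N.sellerPower)) := by
  have hD := measurable_servingDist (N := N) (hF.bs_poisson s hN.mem).measurable
  have hY := hF.measurable_farFactor hN.mem β t
  set L := ENNReal.ofReal (laplaceFormula P N F s l x β (β * t ^ N.α / N.sellerPower)) with hL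
  have h1 := hF.lintegral_indicator_farFactor hN hβ hr hrt ht
  have h2 := hF.lintegral_indicator_farFactor hN hβ ht.le le_rfl ht
  have hA : MeasurableSet {ω | r ≤ servingDist N F s ω ∧ servingDist N F s ω < t} :=
    hD measurableSet_Ico
  have hB : MeasurableSet {ω | t ≤ servingDist N F s ω} := hD measurableSet_Ici
  have hunion : {ω | r ≤ servingDist N F s ω} =
      {ω | r ≤ servingDist N F s ω ∧ servingDist N F s ω < t} ∪ {ω | t ≤ servingDist N F s ω} := by
    ext ω
    simp only [mem_ofPred_eq, mem_union]
    constructor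
    · intro h
      rcases lt_or_ge (servingDist N F s ω) t with h' | h'
      · exact Or.inl ⟨h, h'⟩
      · exact Or.inr h'
    · rintro (h | h)
      · exact h.1
      · exact hrt.trans h
  have hd : Disjoint {ω | r ≤ servingDist N F s ω ∧ servingDist N F s ω < t}
      {ω | t ≤ servingDist N F s ω} :=
    Set.disjoint_left.2 fun ω h h' => absurd h.2 (not_lt.2 h')
  rw [hunion, indicator_union_of_disjoint hd, measure_union hd hB,
    lintegral_add_left (hY.indicator hA), h2, add_mul] at h1
  exact (ENNReal.add_left_inj (ENNReal.mul_ne_top (measure_ne_top _ _) ENNReal.ofReal_ne_top)).1 h1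

lemma continuous_laplaceFormula (P : Measure Ω) (N : Network MNO Band) (F : Randomness MNO Band Ω)
    (s : MNO) (l : Band) (x : Plane) (β : ℝ) : Continuous (laplaceFormula P N F s l x β) := by
  have hα := N.two_lt_α
  have h2 : 0 ≤ 2 / N.α := by positivity
  have e2 : Continuous fun θ : ℝ => θ ^ (2 / N.α) := continuous_id.rpow_const fun _ => Or.inr h2
  unfold laplaceFormula
  fun_prop

lemma laplaceFormula_nonneg (P : Measure Ω) (N : Network MNO Band) (F : Randomness MNO Band Ω)
    (s : MNO) (l : Band) (x : Plane) (β κ : ℝ) : 0 ≤ laplaceFormula P N F s l x β κ := by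
  unfold laplaceFormula; positivity

lemma laplaceFormula_le_one (hF : IsModel P N F s l x) (hN : PositiveParameters N s l) {β κ : ℝ}
    (hβ : 0 < β) (hκ : 0 ≤ κ) : laplaceFormula P N F s l x β κ ≤ 1 := by
  have hp := N.sellerPower_pos
  have hM := powerMoment_nonneg hF hN.threshold.le
  have hρ := rhoInfty_nonneg N.α
  have hρ' := rho_nonneg N.α hβ.le
  have hls := (hN.bs s hN.mem).le
  have hlb : 0 ≤ buyerIntensity N s l :=
    Finset.sum_nonneg fun b hb => (hN.bs b (Finset.mem_of_mem_erase hb)).le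
  rw [laplaceFormula, ← Real.exp_add, Real.exp_le_one_iff]
  have h1 : 0 ≤ Real.pi * N.bsIntensity s * N.sellerPower ^ (2 / N.α) * κ ^ (2 / N.α) *
    rho N.α β := by positivity
  have h2 : 0 ≤ Real.pi * buyerIntensity N s l * powerMoment P N F s l x * κ ^ (2 / N.α) *
    rhoInfty N.α := by positivity
  linarith

lemma continuous_laplaceArgument (N : Network MNO Band) (β : ℝ) :
    Continuous fun t : ℝ => β * t ^ N.α / N.sellerPower := by
  have hα := N.two_lt_α
  have e : Continuous fun t : ℝ => t ^ N.α :=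
    continuous_id.rpow_const fun _ => Or.inr (by positivity)
  fun_prop

/-- The right end of the cell of the grid of mesh `1 / (k + 1)` that contains `r`. -/
def gridAbove (k : ℕ) (r : ℝ) : ℝ := (⌊r * (k + 1)⌋₊ + 1) / (k + 1)

/-- Strictness, valid also at grid points, keeps the serving station out of the far sum. -/
lemma lt_gridAbove (k : ℕ) (r : ℝ) : r < gridAbove k r := by
  rw [gridAbove, lt_div_iff₀ (by positivity)]
  exact Nat.lt_floor_add_one _

lemma gridAbove_le (k : ℕ) {r : ℝ} (hr : 0 ≤ r) : gridAbove k r ≤ r + 1 / ((k : ℝ) + 1) := by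
  rw [gridAbove, div_le_iff₀ (by positivity), add_mul, one_div_mul_cancel (by positivity)]
  have := Nat.floor_le (show 0 ≤ r * ((k : ℝ) + 1) by positivity)
  linarith

lemma tendsto_gridAbove {r : ℝ} (hr : 0 ≤ r) : Tendsto (fun k => gridAbove k r) atTop (𝓝 r) := by
  refine tendsto_of_tendsto_of_tendsto_of_le_of_le tendsto_const_nhds ?_
    (fun k => (lt_gridAbove k r).le) (fun k => gridAbove_le k hr)
  simpa using (tendsto_one_div_add_atTop_nhds_zero_nat (𝕜 := ℝ)).const_add r

/-- On each cell the grid value is constant, so the cell identities, weighted by `φ`, add up. -/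
lemma IsModel.lintegral_gridAbove [IsProbabilityMeasure P] (hF : IsModel P N F s l x)
    (hN : PositiveParameters N s l) {β : ℝ} (hβ : 0 < β) (φ : ℝ → ℝ≥0∞) (k : ℕ) :
    ∫⁻ ω, φ (gridAbove k (servingDist N F s ω)) *
        farFactor N F s l β (gridAbove k (servingDist N F s ω)) ω ∂P =
      ∫⁻ ω, φ (gridAbove k (servingDist N F s ω)) * ENNReal.ofReal (laplaceFormula P N F s l x β
        (β * gridAbove k (servingDist N F s ω) ^ N.α / N.sellerPower)) ∂P := by
  have hD := measurable_servingDist (N := N) (hF.bs_poisson s hN.mem).measurable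
  have hJ : Measurable fun ω => ⌊servingDist N F s ω * ((k : ℝ) + 1)⌋₊ :=
    Nat.measurable_floor.comp (hD.mul_const _)
  let t : ℕ → ℝ := fun j => ((j : ℝ) + 1) / (k + 1)
  have h1 := lintegral_comp_nat (P := P) hJ (g := fun j ω => φ (t j) * farFactor N F s l β (t j) ω)
    fun j => measurable_const.mul (hF.measurable_farFactor hN.mem β (t j))
  have h2 := lintegral_comp_nat (P := P) hJ (g := fun j _ => φ (t j) * ENNReal.ofReal
    (laplaceFormula P N F s l x β (β * t j ^ N.α / N.sellerPower))) fun j => measurable_const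
  refine h1.trans (Eq.trans (tsum_congr fun j => ?_) h2.symm)
  have hk : (0 : ℝ) < k + 1 := by positivity
  have hset : {ω | ⌊servingDist N F s ω * ((k : ℝ) + 1)⌋₊ = j} =
      {ω | j / (k + 1) ≤ servingDist N F s ω ∧ servingDist N F s ω < t j} := by
    ext ω
    rw [mem_ofPred_eq, Nat.floor_eq_iff (mul_nonneg (servingDist_nonneg ω) hk.le), mem_ofPred_eq,
      div_le_iff₀ hk, lt_div_iff₀ hk]
  have hS : MeasurableSet {ω | ⌊servingDist N F s ω * ((k : ℝ) + 1)⌋₊ = j} :=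
    hJ (measurableSet_singleton j)
  have hjt : (j : ℝ) / (k + 1) ≤ t j := by simp only [t]; gcongr; linarith
  have hcell := hF.lintegral_cell_farFactor hN hβ (r := j / (k + 1)) (t := t j) (by positivity) hjt
    (by positivity)
  rw [← hset] at hcell
  rw [lintegral_indicator hS, lintegral_const_mul _ (hF.measurable_farFactor hN.mem β (t j)),
    ← lintegral_indicator hS, hcell, lintegral_indicator hS, lintegral_const,
    Measure.restrict_apply_univ]
  ring

/-- Every other station is strictly farther than the serving one, and only finitely many lie within
`r + 1`, so a fine grid point separates them all from it. Stations beyond `r + 1` are never cut off,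
the mesh being at most `1`. -/
lemma InGeneralPosition.eventually_sellerFar_eq {Ω : Type*} {F : Randomness MNO Band Ω} {ω : Ω}
    (h : InGeneralPosition fun n => F.bs s n ω) : ∀ᶠ k in atTop,
      sellerFar N F s l (gridAbove k (servingDist N F s ω)) ω +
        ∑ b ∈ (N.group l).erase s, buyerInterference N F l b ω = interference N F s l ω := by
  set r := servingDist N F s ω with hr
  have hr0 : 0 ≤ r := servingDist_nonneg ω
  have h1 : ∀ᶠ k in atTop, ∀ n ∈ {n | ‖F.bs s n ω‖ < r + 1},
      n ≠ servingBS N F s ω → gridAbove k r ≤ ‖F.bs s n ω‖ := by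
    refine ((h.finite (r + 1)).eventually_all).2 fun n _ => ?_
    by_cases hn : n = servingBS N F s ω
    · exact Eventually.of_forall fun k hn' => absurd hn hn'
    · filter_upwards [(tendsto_gridAbove hr0).eventually_lt_const (h.servingDist_lt hn)] with k hk _
      exact hk.le
  filter_upwards [h1] with k hk
  rw [interference_eq, interferenceExcept, sellerFar]
  congr 1
  refine tsum_congr fun n => ?_
  have hiff : gridAbove k r ≤ ‖F.bs s n ω‖ ↔ n ≠ servingBS N F s ω := by
    constructor
    · rintro hle rfl
      exact absurd (lt_gridAbove k r) (not_lt.2 hle)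
    · intro hn
      by_cases hlt : ‖F.bs s n ω‖ < r + 1
      · exact hk n hlt hn
      · refine (gridAbove_le k hr0).trans (le_trans ?_ (not_lt.1 hlt))
        have : 1 / ((k : ℝ) + 1) ≤ 1 := by
          rw [div_le_one (by positivity)]; linarith [(Nat.cast_nonneg k : (0 : ℝ) ≤ k)]
        linarith
  simp only [hiff]

/-- The conditional Laplace transform of the interference, tested against bounded continuous
functions of the serving distance. -/
lemma IsModel.lintegral_continuous_mul_expNeg [IsProbabilityMeasure P] (hF : IsModel P N F s l x)
    (hN : PositiveParameters N s l) {β : ℝ} (hβ : 0 < β) (φ : BoundedContinuousFunction ℝ ℝ≥0) :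
    ∫⁻ ω, φ (servingDist N F s ω) * expNeg (ENNReal.ofReal
        (β * servingDist N F s ω ^ N.α / N.sellerPower) * interference N F s l ω) ∂P =
      ∫⁻ ω, φ (servingDist N F s ω) * ENNReal.ofReal (laplaceFormula P N F s l x β
        (β * servingDist N F s ω ^ N.α / N.sellerPower)) ∂P := by
  have hX := (hF.bs_poisson s hN.mem).measurable
  have hD := measurable_servingDist (N := N) hX
  have hJ : ∀ k : ℕ, Measurable fun ω => ⌊servingDist N F s ω * ((k : ℝ) + 1)⌋₊ := fun k =>
    Nat.measurable_floor.comp (hD.mul_const _)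
  have hG : ∀ k, Measurable fun ω => gridAbove k (servingDist N F s ω) := fun k =>
    (measurable_of_countable fun j : ℕ => ((j : ℝ) + 1) / (k + 1)).comp (hJ k)
  have hφ : Continuous fun r => (φ r : ℝ≥0∞) := ENNReal.continuous_coe.comp φ.continuous
  have hκ := continuous_laplaceArgument N β
  have hL := continuous_laplaceFormula P N F s l x β
  have hbound : ∀ r, (φ r : ℝ≥0∞) ≤ nndist φ 0 := fun r => by
    exact_mod_cast BoundedContinuousFunction.NNReal.upper_bound φ r
  have hgrid : ∀ ω, Tendsto (fun k => gridAbove k (servingDist N F s ω)) atTop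
      (𝓝 (servingDist N F s ω)) := fun ω => tendsto_gridAbove (servingDist_nonneg ω)
  have hleft : Tendsto (fun k => ∫⁻ ω, φ (gridAbove k (servingDist N F s ω)) *
      farFactor N F s l β (gridAbove k (servingDist N F s ω)) ω ∂P) atTop
      (𝓝 (∫⁻ ω, φ (servingDist N F s ω) * expNeg (ENNReal.ofReal
        (β * servingDist N F s ω ^ N.α / N.sellerPower) * interference N F s l ω) ∂P)) := by
    refine tendsto_lintegral_of_dominated_convergence (fun _ => nndist φ 0) (fun k => ?_)
      (fun k => ae_of_all _ fun ω => ?_) (by simp) ?_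
    · exact (hφ.measurable.comp (hG k)).mul (measurable_comp_nat (hJ k)
        (g := fun j => farFactor N F s l β ((j + 1) / (k + 1)))
        fun j => hF.measurable_farFactor hN.mem β _)
    · exact (mul_le_mul' (hbound _) (expNeg_le_one _)).trans_eq (mul_one _)
    · filter_upwards [(hF.bs_poisson s hN.mem).ae_inGeneralPosition (hN.bs s hN.mem).le,
        hF.ae_interference_lt_top hN.mem (fun k hk => (hN.bs k hk).le) hN.ue hN.threshold]
        with ω hω hI
      refine ENNReal.Tendsto.mul ((hφ.tendsto _).comp (hgrid ω)) (Or.inr (expNeg_ne_top _)) ?_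
        (Or.inr ENNReal.coe_ne_top)
      -- Finiteness of the interference makes multiplication by it continuous.
      have h1 : Tendsto (fun k => expNeg (ENNReal.ofReal
          (β * gridAbove k (servingDist N F s ω) ^ N.α / N.sellerPower) * interference N F s l ω))
          atTop (𝓝 (expNeg (ENNReal.ofReal
            (β * servingDist N F s ω ^ N.α / N.sellerPower) * interference N F s l ω))) :=
        (continuous_expNeg.tendsto _).comp (ENNReal.Tendsto.mul_const
          (ENNReal.tendsto_ofReal ((hκ.tendsto _).comp (hgrid ω))) (Or.inr hI.ne))
      refine h1.congr' ?_
      filter_upwards [hω.eventually_sellerFar_eq (N := N) (l := l)] with k hk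
      rw [farFactor, hk]
  have hright : Tendsto (fun k => ∫⁻ ω, φ (gridAbove k (servingDist N F s ω)) * ENNReal.ofReal
      (laplaceFormula P N F s l x β
        (β * gridAbove k (servingDist N F s ω) ^ N.α / N.sellerPower)) ∂P) atTop
      (𝓝 (∫⁻ ω, φ (servingDist N F s ω) * ENNReal.ofReal (laplaceFormula P N F s l x β
        (β * servingDist N F s ω ^ N.α / N.sellerPower)) ∂P)) := by
    have hc : Continuous fun r => (φ r : ℝ≥0∞) * ENNReal.ofReal (laplaceFormula P N F s l x β
        (β * r ^ N.α / N.sellerPower)) :=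
      hφ.ennreal_mul (ENNReal.continuous_ofReal.comp (hL.comp hκ))
        (fun _ => Or.inr ENNReal.ofReal_ne_top) (fun _ => Or.inr ENNReal.coe_ne_top)
    refine tendsto_lintegral_of_dominated_convergence (fun _ => nndist φ 0)
      (fun k => hc.measurable.comp (hG k)) (fun k => ae_of_all _ fun ω => ?_) (by simp)
      (ae_of_all _ fun ω => (hc.tendsto _).comp (hgrid ω))
    refine (mul_le_mul' (hbound _) (ENNReal.ofReal_le_one.2
      (laplaceFormula_le_one hF hN hβ ?_))).trans_eq (mul_one _)
    have := (servingDist_nonneg (N := N) (F := F) (s := s) ω).trans (lt_gridAbove k _).le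
    have hp := N.sellerPower_pos
    positivity
  have hgridEq := funext (hF.lintegral_gridAbove hN hβ fun r => (φ r : ℝ≥0∞))
  rw [hgridEq] at hleft
  exact tendsto_nhds_unique hleft hright

end

/-! ### Conditioning on the serving distance and integrating out the serving gain. -/

section

variable {MNO Band Ω : Type*} [DecidableEq MNO] {N : Network MNO Band} {F : Randomness MNO Band Ω}
  {s : MNO} {l : Band} {x : Plane}

/-- The σ-algebra of all the sources of randomness but the gain of BS number `n` of the seller. -/
@[reducible] def otherSigma (N : Network MNO Band) (F : Randomness MNO Band Ω) (s : MNO) (l : Band)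
    (hs : s ∈ N.group l) (n : ℕ) : MeasurableSpace Ω :=
  ⨆ i ∈ {i : Source N s l | i ≠ .gain ⟨s, hs⟩ n}, Source.sigma F i

lemma measurable_bs_otherSigma (hs : s ∈ N.group l) (n : ℕ) {k : MNO} (hk : k ∈ N.group l)
    (m : ℕ) : Measurable[otherSigma N F s l hs n] (F.bs k m) :=
  (measurable_pointSigma (F.bs k) m).mono
    (Source.sigma_le_iSup (i := (.bs ⟨k, hk⟩ : Source N s l)) (by simp)) le_rfl

lemma measurable_gain_otherSigma (hs : s ∈ N.group l) {n : ℕ} {k : MNO} (hk : k ∈ N.group l)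
    {m : ℕ} (h : k ≠ s ∨ m ≠ n) : Measurable[otherSigma N F s l hs n] (F.gain l k m) :=
  (comap_measurable (F.gain l k m)).mono
    (Source.sigma_le_iSup (i := (.gain ⟨k, hk⟩ m : Source N s l)) (by simp; tauto)) le_rfl

lemma measurable_power_otherSigma (hs : s ∈ N.group l) (n : ℕ) {k : MNO}
    (hk : k ∈ (N.group l).erase s) (m : ℕ) :
    Measurable[otherSigma N F s l hs n] (F.power l k m) :=
  (comap_measurable (F.power l k m)).mono
    (Source.sigma_le_iSup (i := (.power ⟨k, hk⟩ m : Source N s l)) (by simp)) le_rfl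

/-- The serving distance uses positions only, and the sum without station `n` does not see its gain;
so the threshold is independent of that gain. -/
lemma measurable_signal_otherSigma (hs : s ∈ N.group l) {κ : ℝ → ℝ≥0∞} (hκ : Measurable κ)
    (c : ℝ≥0∞) (n : ℕ) : Measurable[otherSigma N F s l hs n] fun ω =>
      κ (servingDist N F s ω) * (interferenceExcept N F s l n ω + c) :=
  (hκ.comp (measurable_servingDist fun _ => measurable_bs_otherSigma hs n hs _)).mul
    ((measurable_interferenceExcept (fun _ => measurable_bs_otherSigma hs n hs _)
      (fun _ hm => measurable_gain_otherSigma hs hs (Or.inr hm))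
      fun _ hb => measurable_buyerInterference
        (fun _ => measurable_bs_otherSigma hs n (Finset.mem_of_mem_erase hb) _)
        (fun _ => measurable_power_otherSigma hs n hb _)
        (fun _ => measurable_gain_otherSigma hs (Finset.mem_of_mem_erase hb)
          (Or.inl (Finset.ne_of_mem_erase hb)))).add_const c)

variable [MeasurableSpace Ω] {P : Measure Ω} [IsProbabilityMeasure P]

/-- The conditional Laplace transform of the interference, tested against measurable functions of
the serving distance. -/
lemma IsModel.lintegral_mul_expNeg (hF : IsModel P N F s l x) (hN : PositiveParameters N s l)
    {β : ℝ} (hβ : 0 < β) {ψ : ℝ → ℝ≥0∞} (hψ : Measurable ψ) :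
    ∫⁻ ω, ψ (servingDist N F s ω) * expNeg (ENNReal.ofReal
        (β * servingDist N F s ω ^ N.α / N.sellerPower) * interference N F s l ω) ∂P =
      ∫⁻ ω, ψ (servingDist N F s ω) * ENNReal.ofReal (laplaceFormula P N F s l x β
        (β * servingDist N F s ω ^ N.α / N.sellerPower)) ∂P := by
  have hD := measurable_servingDist (N := N) (hF.bs_poisson s hN.mem).measurable
  have hκ := (continuous_laplaceArgument N β).measurable
  let f : Ω → ℝ≥0∞ := fun ω => expNeg (ENNReal.ofReal
    (β * servingDist N F s ω ^ N.α / N.sellerPower) * interference N F s l ω)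
  let g : Ω → ℝ≥0∞ := fun ω => ENNReal.ofReal (laplaceFormula P N F s l x β
    (β * servingDist N F s ω ^ N.α / N.sellerPower))
  have hf : Measurable f := measurable_expNeg.comp
    ((ENNReal.measurable_ofReal.comp (hκ.comp hD)).mul (hF.measurable_interference hN.mem))
  have hg : Measurable g := ENNReal.measurable_ofReal.comp
    ((continuous_laplaceFormula P N F s l x β).measurable.comp (hκ.comp hD))
  -- Both sides are integrals of `ψ` against images of weighted measures. Finite measures on the
  -- line that agree on bounded continuous functions are equal, hence agree on measurable `ψ`.
  have key : ∀ {h : Ω → ℝ≥0∞}, Measurable h → ∀ {ψ : ℝ → ℝ≥0∞}, Measurable ψ →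
      ∫⁻ r, ψ r ∂((P.withDensity h).map (servingDist N F s)) =
        ∫⁻ ω, ψ (servingDist N F s ω) * h ω ∂P := fun {h} hh {ψ} hψ => by
    rw [lintegral_map hψ hD, lintegral_withDensity_eq_lintegral_mul _ hh
      (g := fun ω => ψ (servingDist N F s ω)) (hψ.comp hD)]
    exact lintegral_congr fun ω => mul_comm _ _
  have hfin : IsFiniteMeasure ((P.withDensity f).map (servingDist N F s)) := by
    have : IsFiniteMeasure (P.withDensity f) := by
      refine isFiniteMeasure_withDensity (ne_top_of_le_ne_top ENNReal.one_ne_top ?_)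
      refine (lintegral_mono fun ω => expNeg_le_one _).trans ?_
      simp
    infer_instance
  have hμ : (P.withDensity f).map (servingDist N F s) =
      (P.withDensity g).map (servingDist N F s) := by
    refine ext_of_forall_lintegral_eq_of_IsFiniteMeasure fun φ => ?_
    have hφ : Measurable fun r => (φ r : ℝ≥0∞) :=
      (ENNReal.continuous_coe.comp φ.continuous).measurable
    rw [key hf hφ, key hg hφ]
    exact hF.lintegral_continuous_mul_expNeg hN hβ φ
  rw [← key hf hψ, ← key hg hψ, hμ]

/-- The conditional Laplace transform of the interference given the serving distance. -/
theorem IsModel.condExp_exp_interference (hF : IsModel P N F s l x)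
    (hN : PositiveParameters N s l) {β : ℝ} (hβ : 0 < β) :
    P[fun ω => Real.exp (-(β * servingDist N F s ω ^ N.α / N.sellerPower *
          (interference N F s l ω).toReal))
        | MeasurableSpace.comap (servingDist N F s) inferInstance]
      =ᵐ[P] fun ω => laplaceFormula P N F s l x β
        (β * servingDist N F s ω ^ N.α / N.sellerPower) := by
  have hp := N.sellerPower_pos
  have hD := measurable_servingDist (N := N) (hF.bs_poisson s hN.mem).measurable
  have hκ := continuous_laplaceArgument N β
  have hL := continuous_laplaceFormula P N F s l x β
  have hκ0 : ∀ ω, 0 ≤ β * servingDist N F s ω ^ N.α / N.sellerPower := fun ω => by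
    have := servingDist_nonneg (N := N) (F := F) (s := s) ω
    positivity
  have hf : Measurable fun ω => Real.exp (-(β * servingDist N F s ω ^ N.α / N.sellerPower *
      (interference N F s l ω).toReal)) :=
    Real.measurable_exp.comp ((hκ.measurable.comp hD).mul
      (hF.measurable_interference hN.mem).ennreal_toReal).neg
  have hfint : Integrable (fun ω => Real.exp (-(β * servingDist N F s ω ^ N.α / N.sellerPower *
      (interference N F s l ω).toReal))) P := by
    refine Integrable.of_bound hf.aestronglyMeasurable 1 (ae_of_all _ fun ω => ?_)
    rw [Real.norm_of_nonneg (Real.exp_pos _).le, Real.exp_le_one_iff, neg_nonpos]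
    exact mul_nonneg (hκ0 ω) ENNReal.toReal_nonneg
  have hg : Measurable fun ω => laplaceFormula P N F s l x β
      (β * servingDist N F s ω ^ N.α / N.sellerPower) := hL.measurable.comp (hκ.measurable.comp hD)
  have hgint : Integrable (fun ω => laplaceFormula P N F s l x β
      (β * servingDist N F s ω ^ N.α / N.sellerPower)) P := by
    refine Integrable.of_bound hg.aestronglyMeasurable 1 (ae_of_all _ fun ω => ?_)
    rw [Real.norm_of_nonneg (laplaceFormula_nonneg _ _ _ _ _ _ _ _)]
    exact laplaceFormula_le_one hF hN hβ (hκ0 ω)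
  symm
  refine ae_eq_condExp_of_forall_setIntegral_eq hD.comap_le hfint
    (fun _ _ _ => hgint.integrableOn) ?_ ?_
  · rintro _ ⟨S, hS, rfl⟩ -
    rw [integral_eq_lintegral_of_nonneg_ae (ae_of_all _ fun ω => laplaceFormula_nonneg _ _ _ _ _ _ _ _)
      hg.aestronglyMeasurable, integral_eq_lintegral_of_nonneg_ae
      (ae_of_all _ fun ω => (Real.exp_pos _).le) hf.aestronglyMeasurable]
    congr 1
    have hψ : Measurable (S.indicator (1 : ℝ → ℝ≥0∞)) := measurable_one.indicator hS
    have key := hF.lintegral_mul_expNeg hN hβ hψ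
    rw [← lintegral_indicator (hD hS), ← lintegral_indicator (hD hS)]
    refine Eq.trans ?_ (key.symm.trans (lintegral_congr_ae ?_))
    · refine lintegral_congr fun ω => ?_
      by_cases hω : servingDist N F s ω ∈ S
      · rw [indicator_of_mem (by exact hω), indicator_of_mem hω]; simp
      · rw [indicator_of_notMem (by exact hω), indicator_of_notMem hω]; simp
    -- Almost sure finiteness makes `toReal` harmless.
    · filter_upwards [hF.ae_interference_lt_top hN.mem (fun k hk => (hN.bs k hk).le) hN.ue
        hN.threshold] with ω hI
      by_cases hω : servingDist N F s ω ∈ S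
      · rw [indicator_of_mem (by exact hω), indicator_of_mem (by exact hω), Pi.one_apply, one_mul,
          ← expNeg_ofReal (mul_nonneg (hκ0 ω) ENNReal.toReal_nonneg), ENNReal.ofReal_mul (hκ0 ω),
          ENNReal.ofReal_toReal hI.ne]
      · rw [indicator_of_notMem (by exact hω), indicator_of_notMem (by exact hω), zero_mul]
  · exact ((hL.comp hκ).measurable.comp (comap_measurable _)).aestronglyMeasurable

/-- The squared serving distance, suitably normalised, is exponentially distributed. -/
lemma IsModel.map_sq_servingDist (hF : IsModel P N F s l x) (hN : PositiveParameters N s l) :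
    P.map (fun ω => servingDist N F s ω ^ 2 / N.sellerPower ^ (2 / N.α)) =
      expMeasure (Real.pi * N.bsIntensity s * N.sellerPower ^ (2 / N.α)) := by
  have hp := N.sellerPower_pos
  have hls := hN.bs s hN.mem
  have hD := measurable_servingDist (N := N) (hF.bs_poisson s hN.mem).measurable
  set c := N.sellerPower ^ (2 / N.α) with hc
  have hc0 : 0 < c := Real.rpow_pos_of_pos hp _
  have hm : Measurable fun ω => servingDist N F s ω ^ 2 / c := (hD.pow_const 2).div_const c
  have hr : 0 < Real.pi * N.bsIntensity s * c := by positivity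
  have h1 : IsProbabilityMeasure (P.map fun ω => servingDist N F s ω ^ 2 / c) :=
    Measure.isProbabilityMeasure_map hm.aemeasurable
  have h2 := isProbabilityMeasure_expMeasure hr
  refine Measure.eq_of_cdf _ _ (StieltjesFunction.ext fun z => ?_)
  rw [cdf_expMeasure_eq hr, cdf_eq_real, map_measureReal_apply hm measurableSet_Iic]
  split_ifs with hz
  · have hset : (fun ω => servingDist N F s ω ^ 2 / c) ⁻¹' Iic z =
        {ω | Real.sqrt (z * c) < servingDist N F s ω}ᶜ := by
      ext ω
      rw [mem_preimage, mem_Iic, div_le_iff₀ hc0, mem_compl_iff, mem_ofPred_eq, not_lt,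
        Real.le_sqrt (servingDist_nonneg ω) (by positivity)]
    rw [hset, probReal_compl_eq_one_sub (measurableSet_lt measurable_const hD), measureReal_def,
      hF.measure_lt_servingDist hN.mem hls.le (Real.sqrt_nonneg _),
      ENNReal.toReal_ofReal (Real.exp_pos _).le, Real.sq_sqrt (by positivity)]
    congr 3
    ring
  · have hset : (fun ω => servingDist N F s ω ^ 2 / c) ⁻¹' Iic z = ∅ := by
      ext ω
      have : 0 ≤ servingDist N F s ω ^ 2 / c := by positivity
      simp only [mem_preimage, mem_Iic, mem_empty_iff_false, iff_false, not_le]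
      linarith
    simp [hset]

/-- The gain of a BS is independent of all the other sources of randomness. -/
lemma IsModel.gain_indep_otherSigma {P : Measure Ω} (hF : IsModel P N F s l x) (hs : s ∈ N.group l) (n : ℕ) :
    Indep (MeasurableSpace.comap (F.gain l s n) inferInstance) (otherSigma N F s l hs n) P := by
  have hd : Disjoint {(.gain ⟨s, hs⟩ n : Source N s l)}
      {i : Source N s l | i ≠ .gain ⟨s, hs⟩ n} := by simp
  exact indep_of_indep_of_le_left (indep_iSup_of_disjoint hF.source_le hF.indep hd)
    (Source.sigma_le_iSup (F := F) (i := (.gain ⟨s, hs⟩ n : Source N s l)) rfl)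

/-- With `A` frozen the threshold is a constant, and the exponential tail there is `expNeg`. -/
lemma lintegral_indicator_lt_exp {Ω S : Type*} [MeasurableSpace Ω] {P : Measure Ω}
    [IsProbabilityMeasure P] [MeasurableSpace S] {A : Ω → S} (hA : Measurable A) {h : Ω → ℝ}
    (hm : Measurable h) (hlaw : P.map h = expMeasure 1) (hind : IndepFun A h P)
    {T : Set S} (hT : MeasurableSet T) {a : S → ℝ≥0∞} (ha : Measurable a) :
    ∫⁻ ω, (A ⁻¹' T).indicator ({ω | a (A ω) < ENNReal.ofReal (h ω)}.indicator 1) ω ∂P =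
      ∫⁻ ω, (A ⁻¹' T).indicator (fun ω => expNeg (a (A ω))) ω ∂P := by
  have hH : Measurable fun q : S × ℝ =>
      T.indicator (1 : S → ℝ≥0∞) q.1 * {q : S × ℝ | a q.1 < ENNReal.ofReal q.2}.indicator 1 q := by
    refine Measurable.mul ((measurable_one.indicator hT).comp measurable_fst)
      (Measurable.indicator measurable_one ?_)
    exact measurableSet_lt (ha.comp measurable_fst)
      (ENNReal.measurable_ofReal.comp measurable_snd)
  have key := lintegral_comp_prodMk_of_indepFun hA hm hind hH
  rw [hlaw] at key
  refine Eq.trans (lintegral_congr fun ω => ?_) (key.trans (lintegral_congr fun ω => ?_))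
  · by_cases hω : A ω ∈ T
    · simp [hω, indicator]
    · simp [hω]
  · by_cases hω : A ω ∈ T
    · have hset : MeasurableSet {m : ℝ | a (A ω) < ENNReal.ofReal m} :=
        measurableSet_lt measurable_const ENNReal.measurable_ofReal
      rw [indicator_of_mem (show ω ∈ A ⁻¹' T from hω), ← expMeasure_Ioi,
        ← lintegral_indicator_one hset]
      simp [hω, indicator]
    · simp [hω]

/-- Integrating out an exponential threshold that is independent of a σ-algebra. -/
lemma lintegral_indicator_lt_exp_of_indep {Ω : Type*} {𝓐 mΩ : MeasurableSpace Ω} {P : Measure Ω}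
    [IsProbabilityMeasure P] (h𝓐 : 𝓐 ≤ mΩ) {h : Ω → ℝ} (hm : Measurable h)
    (hlaw : P.map h = expMeasure 1) (hind : Indep (MeasurableSpace.comap h inferInstance) 𝓐 P)
    {T : Set Ω} (hT : MeasurableSet[𝓐] T) {a : Ω → ℝ≥0∞} (ha : Measurable[𝓐] a) :
    ∫⁻ ω, T.indicator ({ω | a ω < ENNReal.ofReal (h ω)}.indicator 1) ω ∂P =
      ∫⁻ ω, T.indicator (fun ω => expNeg (a ω)) ω ∂P := by
  have hI : @IndepFun Ω Ω ℝ mΩ 𝓐 _ id h P := by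
    refine (@IndepFun_iff_Indep Ω Ω ℝ mΩ 𝓐 _ id h P).2 ?_
    rw [MeasurableSpace.comap_id]
    exact hind.symm
  exact @lintegral_indicator_lt_exp Ω Ω mΩ P _ 𝓐 id (measurable_id'' h𝓐) h hm hlaw hI T hT a ha

/-- Integrating out the gain of the serving BS. -/
lemma IsModel.measure_lt_servingGain (hF : IsModel P N F s l x) (hs : s ∈ N.group l)
    {κ : ℝ → ℝ≥0∞} (hκ : Measurable κ) (c : ℝ≥0∞) :
    P {ω | κ (servingDist N F s ω) * (interference N F s l ω + c) <
        ENNReal.ofReal (F.gain l s (servingBS N F s ω) ω)} =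
      ∫⁻ ω, expNeg (κ (servingDist N F s ω) * (interference N F s l ω + c)) ∂P := by
  have hX := (hF.bs_poisson s hs).measurable
  have hJ := measurable_servingBS (N := N) hX
  let a : ℕ → Ω → ℝ≥0∞ := fun n ω =>
    κ (servingDist N F s ω) * (interferenceExcept N F s l n ω + c)
  have hle : ∀ n, otherSigma N F s l hs n ≤ ‹MeasurableSpace Ω› := fun n =>
    iSup₂_le fun i _ => hF.source_le i
  have ha : ∀ n, Measurable[otherSigma N F s l hs n] (a n) := fun n =>
    measurable_signal_otherSigma hs hκ c n
  have ha' : ∀ n, Measurable (a n) := fun n => (ha n).mono (hle n) le_rfl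
  have hE : ∀ n, MeasurableSet {ω | a n ω < ENNReal.ofReal (F.gain l s n ω)} := fun n =>
    measurableSet_lt (ha' n) (ENNReal.measurable_ofReal.comp (hF.gain_measurable s hs n))
  have h1 := lintegral_comp_nat (P := P) hJ
    (g := fun n => {ω | a n ω < ENNReal.ofReal (F.gain l s n ω)}.indicator 1)
    fun n => measurable_one.indicator (hE n)
  have h2 := lintegral_comp_nat (P := P) hJ (g := fun n ω => expNeg (a n ω))
    fun n => measurable_expNeg.comp (ha' n)
  have h3 : ∀ n, ∫⁻ ω, {ω | servingBS N F s ω = n}.indicator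
      ({ω | a n ω < ENNReal.ofReal (F.gain l s n ω)}.indicator 1) ω ∂P =
      ∫⁻ ω, {ω | servingBS N F s ω = n}.indicator (fun ω => expNeg (a n ω)) ω ∂P := fun n => by
    -- Association looks at average power, hence at positions only; knowing that station `n` serves
    -- leaves its gain exponential.
    have hS : MeasurableSet[otherSigma N F s l hs n] {ω | servingBS N F s ω = n} :=
      measurable_servingBS (fun m => measurable_bs_otherSigma hs n hs m) (measurableSet_singleton n)
    exact lintegral_indicator_lt_exp_of_indep (hle n) (hF.gain_measurable s hs n) (hF.gain_law s hs n)
      (hF.gain_indep_otherSigma hs n) hS (ha n)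
  rw [tsum_congr h3, ← h2] at h1
  have hset : MeasurableSet {ω | κ (servingDist N F s ω) * (interference N F s l ω + c) <
      ENNReal.ofReal (F.gain l s (servingBS N F s ω) ω)} := by
    refine measurableSet_lt ((hκ.comp (measurable_servingDist hX)).mul
      ((hF.measurable_interference hs).add_const c)) ?_
    exact ENNReal.measurable_ofReal.comp (measurable_comp_nat hJ (hF.gain_measurable s hs))
  rw [← lintegral_indicator_one hset]
  simp only [interference_eq]
  refine Eq.trans (lintegral_congr fun ω => ?_) h1
  by_cases hω : a (servingBS N F s ω) ω <
      ENNReal.ofReal (F.gain l s (servingBS N F s ω) ω)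
  · rw [indicator_of_mem (by exact hω), indicator_of_mem (by exact hω)]
  · rw [indicator_of_notMem (by exact hω), indicator_of_notMem (by exact hω)]

end

/-! ### The coverage probability. -/

section

variable {MNO Band Ω : Type*} [DecidableEq MNO] {N : Network MNO Band} {F : Randomness MNO Band Ω}
  {s : MNO} {l : Band} {x : Plane} [MeasurableSpace Ω] {P : Measure Ω}

lemma PositiveParameters.of_mem (N : Network MNO Band) (hs : s ∈ N.sellers) (hl : l ∈ N.bands s) :
    PositiveParameters N s l where
  mem := N.seller_mem_group s hs l hl
  bs k hk := by
    refine N.bsIntensity_pos k ?_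
    by_cases h : k = s
    · exact Finset.mem_union_left _ (h ▸ hs)
    · exact Finset.mem_union_right _ (N.group_subset s hs l hl (Finset.mem_erase.2 ⟨h, hk⟩))
  ue := N.ueIntensity_pos s (Finset.mem_union_left _ hs)
  threshold := N.threshold_pos s hs

lemma IsModel.measurable_sinr (hF : IsModel P N F s l x) (hs : s ∈ N.group l) :
    Measurable (sinr N F s l) := by
  have hX := (hF.bs_poisson s hs).measurable
  refine Measurable.div (ENNReal.measurable_ofReal.comp ?_)
    ((hF.measurable_interference hs).add_const _)
  exact (measurable_const.mul (measurable_comp_nat (measurable_servingBS hX)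
    (hF.gain_measurable s hs))).mul ((measurable_servingDist hX).pow_const _)

lemma coverageIntegrand_nonneg (hN : PositiveParameters N s l) (β z : ℝ) :
    0 ≤ coverageIntegrand P N F s l x β z := by
  have hls := (hN.bs s hN.mem).le
  have hp := N.sellerPower_pos
  have hL := laplaceFormula_nonneg P N F s l x β (β * z ^ (N.α / 2))
  unfold coverageIntegrand
  positivity

lemma measurable_coverageIntegrand (P : Measure Ω) (N : Network MNO Band)
    (F : Randomness MNO Band Ω) (s : MNO) (l : Band) (x : Plane) (β : ℝ) :
    Measurable (coverageIntegrand P N F s l x β) := by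
  have hL := (continuous_laplaceFormula P N F s l x β).measurable
  unfold coverageIntegrand
  fun_prop

variable [IsProbabilityMeasure P]

/-- The tower property: averaging over the powers undoes the conditioning on them. -/
lemma coverage_eq (hF : IsModel P N F s l x) (hs : s ∈ N.group l) (β : ℝ) :
    coverage P N F s l β = P.real {ω | ENNReal.ofReal β < sinr N F s l ω} := by
  have hle : powerSigma N F s l ≤ ‹MeasurableSpace Ω› :=
    Measurable.comap_le (measurable_pi_lambda _ fun k => measurable_pi_lambda _ fun n =>
      hF.power_measurable k k.2 n)
  rw [coverage, integral_condExp hle, integral_indicator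
    (measurableSet_lt measurable_const (hF.measurable_sinr hs))]
  simp

lemma IsModel.ae_lt_sinr_iff (hF : IsModel P N F s l x) (hN : PositiveParameters N s l) {β : ℝ}
    (hβ : 0 < β) : ∀ᵐ ω ∂P, ENNReal.ofReal β < sinr N F s l ω ↔
      ENNReal.ofReal (β * servingDist N F s ω ^ N.α / N.sellerPower) *
        (interference N F s l ω + ENNReal.ofReal (N.σ ^ 2)) <
      ENNReal.ofReal (F.gain l s (servingBS N F s ω) ω) := by
  have hp := N.sellerPower_pos
  have hh := ae_all_iff.2 fun n =>
    ae_pos_of_map_eq_expMeasure (hF.gain_measurable s hN.mem n) (hF.gain_law s hN.mem n)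
  filter_upwards [(hF.bs_poisson s hN.mem).ae_inGeneralPosition (hN.bs s hN.mem).le, hh] with ω hω hg
  set r := servingDist N F s ω with hr
  set h := F.gain l s (servingBS N F s ω) ω with hhdef
  set D := interference N F s l ω + ENNReal.ofReal (N.σ ^ 2)
  have hr0 : 0 < r := norm_pos_iff.2 (hω.ne_zero _)
  have hh0 : 0 < h := hg _
  set c := N.sellerPower * r ^ (-N.α) with hc
  have hc0 : 0 < c := by positivity
  have hκ : β * r ^ N.α / N.sellerPower = β / c := by
    rw [hc, Real.rpow_neg hr0.le]
    field_simp
  have hnum : N.sellerPower * h * r ^ (-N.α) = h * c := by rw [hc]; ring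
  have hβ' : ENNReal.ofReal β ≠ 0 := by simpa using hβ
  -- As `β` is neither `0` nor `∞`, the denominator may be cleared even where it is `0` or `∞`.
  rw [sinr, ← hr, ← hhdef, hnum, ENNReal.lt_div_iff_mul_lt (Or.inr ENNReal.ofReal_ne_top) (Or.inr hβ'),
    hκ, ENNReal.ofReal_mul hh0.le, ENNReal.ofReal_div_of_pos hc0, mul_comm (_ / _), ← mul_div_assoc,
    ENNReal.div_lt_iff (Or.inl (by simpa using hc0)) (Or.inl ENNReal.ofReal_ne_top),
    mul_comm D]

/-- The probability of coverage, as an expectation over the serving distance. -/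
lemma IsModel.measure_lt_sinr (hF : IsModel P N F s l x) (hN : PositiveParameters N s l) {β : ℝ}
    (hβ : 0 < β) : P {ω | ENNReal.ofReal β < sinr N F s l ω} =
      ∫⁻ z in Ioi (0 : ℝ), ENNReal.ofReal (coverageIntegrand P N F s l x β z) := by
  have hp := N.sellerPower_pos
  have hα := N.two_lt_α
  have hD := measurable_servingDist (N := N) (hF.bs_poisson s hN.mem).measurable
  have hκ := continuous_laplaceArgument N β
  have hL := continuous_laplaceFormula P N F s l x β
  set c := N.sellerPower ^ (2 / N.α) with hc
  have hc0 : 0 < c := Real.rpow_pos_of_pos hp _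
  set rate := Real.pi * N.bsIntensity s * c with hrate
  let G : ℝ → ℝ≥0∞ := fun z => ENNReal.ofReal (Real.exp (-(β * N.σ ^ 2 * z ^ (N.α / 2)))) *
    ENNReal.ofReal (laplaceFormula P N F s l x β (β * z ^ (N.α / 2)))
  have hG : Measurable G := by
    have := hL.measurable
    fun_prop
  let ψ : ℝ → ℝ≥0∞ := fun r => expNeg (ENNReal.ofReal (β * r ^ N.α / N.sellerPower) *
    ENNReal.ofReal (N.σ ^ 2))
  have hψ : Measurable ψ := measurable_expNeg.comp
    ((ENNReal.measurable_ofReal.comp hκ.measurable).mul_const _)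
  have h1 : P {ω | ENNReal.ofReal β < sinr N F s l ω} =
      P {ω | ENNReal.ofReal (β * servingDist N F s ω ^ N.α / N.sellerPower) *
        (interference N F s l ω + ENNReal.ofReal (N.σ ^ 2)) <
        ENNReal.ofReal (F.gain l s (servingBS N F s ω) ω)} := by
    refine measure_congr ?_
    filter_upwards [hF.ae_lt_sinr_iff hN hβ] with ω hω using propext hω
  have h2 := hF.measure_lt_servingGain hN.mem
    (ENNReal.measurable_ofReal.comp hκ.measurable) (ENNReal.ofReal (N.σ ^ 2))
  simp only [Function.comp_apply] at h2
  rw [h1, h2]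
  have h3 : ∀ ω, expNeg (ENNReal.ofReal (β * servingDist N F s ω ^ N.α / N.sellerPower) *
      (interference N F s l ω + ENNReal.ofReal (N.σ ^ 2))) = ψ (servingDist N F s ω) *
        expNeg (ENNReal.ofReal (β * servingDist N F s ω ^ N.α / N.sellerPower) *
          interference N F s l ω) := fun ω => by
    rw [mul_add, expNeg_add, mul_comm]
  have h4 : ∀ ω, ψ (servingDist N F s ω) * ENNReal.ofReal (laplaceFormula P N F s l x β
      (β * servingDist N F s ω ^ N.α / N.sellerPower)) = G (servingDist N F s ω ^ 2 / c) := by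
    intro ω
    have hr := servingDist_nonneg (N := N) (F := F) (s := s) ω
    -- In the variable `z = D ^ 2 / c` the argument `β D ^ α / Pˢ` becomes `β z ^ (α / 2)`, and `z`
    -- is exponential with parameter `rate`.
    have e : (servingDist N F s ω ^ 2 / c) ^ (N.α / 2) = servingDist N F s ω ^ N.α / N.sellerPower := by
      rw [Real.div_rpow (by positivity) hc0.le, hc, ← Real.rpow_mul hp.le, ← Real.rpow_natCast,
        ← Real.rpow_mul hr]
      have e1 : 2 / N.α * (N.α / 2) = 1 := by field_simp
      have e2 : ((2 : ℕ) : ℝ) * (N.α / 2) = N.α := by push_cast; ring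
      rw [e1, e2, Real.rpow_one]
    simp only [ψ, G, e]
    rw [← ENNReal.ofReal_mul (by positivity), expNeg_ofReal (by positivity)]
    congr 3
    · ring
    · ring
  simp_rw [h3]
  rw [hF.lintegral_mul_expNeg hN hβ hψ]
  simp_rw [h4]
  rw [← lintegral_map hG ((hD.pow_const 2).div_const c), hF.map_sq_servingDist hN,
    lintegral_expMeasure hG, ← lintegral_indicator measurableSet_Ioi]
  refine lintegral_congr_ae ?_
  have hne : ∀ᵐ z : ℝ, z ≠ 0 := by simp [ae_iff]
  filter_upwards [hne] with z hz
  rcases lt_or_gt_of_ne hz with hz | hz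
  · rw [exponentialPDF_of_neg hz, zero_mul, indicator_of_notMem]
    exact not_lt.2 hz.le
  · have hls := (hN.bs s hN.mem).le
    rw [indicator_of_mem (by exact hz), exponentialPDF_of_nonneg hz.le]
    simp only [G]
    rw [← ENNReal.ofReal_mul (Real.exp_pos _).le, ← ENNReal.ofReal_mul (by positivity),
      coverageIntegrand]
    congr 1
    ring

end

end

end SpectrumSharing

open SpectrumSharing in
theorem theorem2 {MNO Band Ω : Type*} [DecidableEq MNO] [MeasurableSpace Ω]
    (P : Measure Ω) [IsProbabilityMeasure P]
    (N : Network MNO Band) (F : Randomness MNO Band Ω)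
    (s : MNO) (hs : s ∈ N.sellers) (l : Band) (hl : l ∈ N.bands s)
    (x : Plane) (hF : IsModel P N F s l x)
    (β : ℝ) (hβ : 0 < β) :
    -- the power moment is finite, and so is the interference
    Integrable (fun ω => buyerPower N F s l x ω ^ (2 / N.α)) P ∧
    (∀ᵐ ω ∂P, interference N F s l ω < ∞) ∧
    -- the Laplace transform of the interference given the serving distance `r`, at `β * r ^ α / Pˢ`
    (P[fun ω => Real.exp (-(β * servingDist N F s ω ^ N.α / N.sellerPower *
          (interference N F s l ω).toReal))
        | MeasurableSpace.comap (servingDist N F s) inferInstance]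
      =ᵐ[P] fun ω => laplaceFormula P N F s l x β
        (β * servingDist N F s ω ^ N.α / N.sellerPower)) ∧
    -- the coverage probability
    IntegrableOn (coverageIntegrand P N F s l x β) (Ioi 0) ∧
    coverage P N F s l β = ∫ z in Ioi (0 : ℝ), coverageIntegrand P N F s l x β z := by
  have hN := PositiveParameters.of_mem N hs hl
  have hmeas := measurable_coverageIntegrand P N F s l x β
  have hnn : 0 ≤ᵐ[volume.restrict (Ioi 0)] coverageIntegrand P N F s l x β :=
    ae_of_all _ fun z => coverageIntegrand_nonneg hN β z
  have hcov := hF.measure_lt_sinr hN hβ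
  refine ⟨integrable_buyerPower_rpow hF hN.ue hN.threshold,
    hF.ae_interference_lt_top hN.mem (fun k hk => (hN.bs k hk).le) hN.ue hN.threshold,
    hF.condExp_exp_interference hN hβ, ?_, ?_⟩
  -- The integral of the nonnegative integrand is a probability, hence finite.
  · rw [IntegrableOn, ← lintegral_ofReal_ne_top_iff_integrable hmeas.aestronglyMeasurable hnn,
      ← hcov]
    exact measure_ne_top _ _
  · rw [coverage_eq hF hN.mem, measureReal_def, hcov,
      integral_eq_lintegral_of_nonneg_ae hnn hmeas.aestronglyMeasurable]
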